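/- Let $k\ge 1$ and consider the system $x_{t+1}=Ax_t+Bu_t+w_t$, $y_t=Cx_t+Du_t$, $t=0,1,\dots$, with $A\in\mathbb{R}^{n\times n}$, $B\in\mathbb{R}^{n\times m}$, $C\in\mathbb{R}^{r\times n}$, $D\in\mathbb{R}^{r\times m}$, random initial state $x_0$, inputs $u_t$ and attacks $w_t$. Let $\mathcal{F}_t=\sigma(x_0,w_0,\dots,w_{t-1})$, and for a real random variable $X$ let $\|X\|_{\psi_2}=\inf\{s>0:\mathbb{E}[e^{X^2/s^2}]\le 2\}$. Assume: (i) (stability) there are $\psi>0$ and $0\le\rho<1$ with $\|A^t\|_2\le\psi\rho^t$ for all $t\ge 0$; (ii) (sub-Gaussian norm) there is $\eta>0$ such that $\big\|\|x_0\|_2\big\|_{\psi_2}\le\eta$ and, for all $t\ge 0$, the $\psi_2$-norm of $\|w_t\|_2$ conditioned on $\mathcal{F}_t$ is at most $\eta$, i.e. $\mathbb{E}[e^{\|w_t\|_2^2/\eta^2}\mid\mathcal{F}_t]\le 2$ almost surely; (iii) (probabilistic attack) there are $p\in[0,1]$ with $2(k-1)p<1$ (that is, $p<\frac{1}{2(k-1)}$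 if $k\ge 2$) and a sequence $(\xi_t)_{t\ge 0}$ of independent Bernoulli$(p)$ variables, each $\xi_t$ independent of $\mathcal{F}_t$, such that $\{\xi_t=0\}\subseteq\{w_t=0\}$ for all $t\ge 0$; (iv) (inputs) $u_0,\dots,u_{T+k-2}$ are independent with law $N(0,\sigma^2I_m)$, $\sigma>0$, and $(u_0,\dots,u_{T+k-2})$ is independent of $(\xi_t)_{t\ge0}$. Let $G^*=[D\ \ CB\ \ CAB\ \cdots\ CA^{k-2}B]$, $\mathbf{U}_t^{(k)}=[u_t^T\ u_{t-1}^T\cdots u_{t-k+1}^T]^T$, $q=1-(1-p)^{k-1}$ and $\nu=\frac{\|C\|_2}{1-2q}\big(\frac{\eta}{\sigma}+\sqrt{m}\,\|B\|_2\big)$. There are a universal constant $c_1>0$ and a constant $c_2>0$ depending only on $\psi$ (in particular neither depends on the observation dimension $r$) such that for every $\delta\in(0,1]$ and every $$T\ \ge\ c_1\,\frac{k}{(1-2q)^2}\Big[mk\log\Big(\frac{mk}{1-2q}\Big)+\log\Big(\frac1\delta\Big)\Big],$$ with probability at least $1-\delta$ every minimizer $\hat G_T^*$ of $\sum_{t=k-1}^{T+k-2}\|y_t-G\,\mathbf{U}_t^{(k)}\|_2$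 over $G\in\mathbb{R}^{r\times mk}$ satisfies $$\|G^*-\hat G_T^*\|_F\ \le\ c_2\,\frac{\rho^{k-1}\nu}{1-\rho}.$$ -/

import Mathlib

open MeasureTheory ProbabilityTheory

noncomputable section

namespace SysId

/-- The spectral norm (the operator norm between Euclidean spaces) of a real matrix. -/
def specNorm {a b : ℕ} (M : Matrix (Fin a) (Fin b) ℝ) : ℝ :=
  ‖LinearMap.toContinuousLinearMap (Matrix.toEuclideanLin M)‖

/-- The Frobenius norm of a real matrix. -/
def frobNorm {ι κ : Type*} [Fintype ι] [Fintype κ] (M : Matrix ι κ ℝ) : ℝ :=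
  Real.sqrt (∑ i, ∑ j, M i j ^ 2)

/-- The state `x_t` of the system `x_{t+1} = A x_t + B u_t + w_t` started at `x₀`. -/
def state {n m : ℕ} (A : Matrix (Fin n) (Fin n) ℝ) (B : Matrix (Fin n) (Fin m) ℝ)
    (x₀ : EuclideanSpace ℝ (Fin n)) (u : ℕ → EuclideanSpace ℝ (Fin m))
    (w : ℕ → EuclideanSpace ℝ (Fin n)) : ℕ → EuclideanSpace ℝ (Fin n)
  | 0 => x₀
  | t + 1 => Matrix.toEuclideanLin A (state A B x₀ u w t) + Matrix.toEuclideanLin B (u t) + w t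

/-- The observation `y_t = C x_t + D u_t`. -/
def observation {n m r : ℕ} (A : Matrix (Fin n) (Fin n) ℝ) (B : Matrix (Fin n) (Fin m) ℝ)
    (C : Matrix (Fin r) (Fin n) ℝ) (D : Matrix (Fin r) (Fin m) ℝ)
    (x₀ : EuclideanSpace ℝ (Fin n)) (u : ℕ → EuclideanSpace ℝ (Fin m))
    (w : ℕ → EuclideanSpace ℝ (Fin n)) (t : ℕ) : EuclideanSpace ℝ (Fin r) :=
  Matrix.toEuclideanLin C (state A B x₀ u w t) + Matrix.toEuclideanLin D (u t)

/-- The Markov parameter matrix `G* = [D  CB  CAB  ⋯  CA^{k-2}B]` of order `k`. The columns are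
indexed by `(j, l)`: block `j` (counted from `0`) and column `l` inside the block. -/
def markovMatrix {n m r : ℕ} (A : Matrix (Fin n) (Fin n) ℝ) (B : Matrix (Fin n) (Fin m) ℝ)
    (C : Matrix (Fin r) (Fin n) ℝ) (D : Matrix (Fin r) (Fin m) ℝ) (k : ℕ) :
    Matrix (Fin r) (Fin k × Fin m) ℝ :=
  Matrix.of fun i jl =>
    if jl.1.val = 0 then D i jl.2 else (C * A ^ (jl.1.val - 1) * B) i jl.2

/-- The stacked input vector `U_t^{(k)} = [u_tᵀ u_{t-1}ᵀ ⋯ u_{t-k+1}ᵀ]ᵀ`, used for `t ≥ k - 1`. -/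
def inputWindow {m : ℕ} (k : ℕ) (u : ℕ → EuclideanSpace ℝ (Fin m)) (t : ℕ) :
    EuclideanSpace ℝ (Fin k × Fin m) :=
  WithLp.toLp 2 fun jl => u (t - jl.1.val) jl.2

/-- The objective `∑_{t=k-1}^{T+k-2} ‖y_t - G U_t^{(k)}‖₂` (the sum has `T` terms). -/
def l2Objective {m r : ℕ} (k T : ℕ) (u : ℕ → EuclideanSpace ℝ (Fin m))
    (y : ℕ → EuclideanSpace ℝ (Fin r)) (G : Matrix (Fin r) (Fin k × Fin m) ℝ) : ℝ :=
  ∑ t ∈ Finset.Ico (k - 1) (T + k - 1), ‖y t - Matrix.toEuclideanLin G (inputWindow k u t)‖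

/-- `G` is a value of the `ℓ₂`-norm estimator: a global minimizer of the objective. -/
def IsL2Estimate {m r : ℕ} (k T : ℕ) (u : ℕ → EuclideanSpace ℝ (Fin m))
    (y : ℕ → EuclideanSpace ℝ (Fin r)) (G : Matrix (Fin r) (Fin k × Fin m) ℝ) : Prop :=
  ∀ G' : Matrix (Fin r) (Fin k × Fin m) ℝ, l2Objective k T u y G ≤ l2Objective k T u y G'

/-- `‖A^t‖₂ ≤ ψ ρ^t` for all `t ≥ 0`, with `ψ > 0` and `0 ≤ ρ < 1`. -/
structure IsStable {n : ℕ} (A : Matrix (Fin n) (Fin n) ℝ) (ψ ρ : ℝ) : Prop where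
  psi_pos : 0 < ψ
  rho_nonneg : 0 ≤ ρ
  rho_lt_one : ρ < 1
  bound : ∀ t : ℕ, specNorm (A ^ t) ≤ ψ * ρ ^ t

section Probability

variable {Ω : Type*} [MeasurableSpace Ω]

/-- The sub-Gaussian norm `inf {t > 0 : E[exp (X² / t²)] ≤ 2}`, equal to `∞` if there is no
such `t`. -/
def psi2Norm (P : Measure Ω) (X : Ω → ℝ) : ENNReal :=
  sInf (ENNReal.ofReal ''
    {t : ℝ | 0 < t ∧ ∫⁻ ω, ENNReal.ofReal (Real.exp (X ω ^ 2 / t ^ 2)) ∂P ≤ 2})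

/-- The sub-Gaussian norm of `X` conditioned on `F` is at most `η > 0` almost surely. By monotone
convergence the infimum that defines the norm is attained, so this says that
`E[exp (X² / η²) | F] ≤ 2` almost surely. -/
def CondPsi2NormLE (P : Measure Ω) (F : MeasurableSpace Ω) (X : Ω → ℝ) (η : ℝ) : Prop :=
  Integrable (fun ω => Real.exp (X ω ^ 2 / η ^ 2)) P ∧
    P[fun ω => Real.exp (X ω ^ 2 / η ^ 2) | F] ≤ᵐ[P] fun _ => 2

/-- The σ-algebra `F_t = σ(x₀, w₀, …, w_{t-1})`. -/
@[reducible]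
def attackHistory {n : ℕ} (x₀ : Ω → EuclideanSpace ℝ (Fin n))
    (w : ℕ → Ω → EuclideanSpace ℝ (Fin n)) (t : ℕ) : MeasurableSpace Ω :=
  MeasurableSpace.comap x₀ inferInstance ⊔
    ⨆ s : Fin t, MeasurableSpace.comap (w s) inferInstance

/-- The initial state and, conditioned on the past, every attack have (Euclidean norms with)
sub-Gaussian norm at most `η > 0`. -/
structure IsSubGaussianAttack {n : ℕ} (P : Measure Ω) (x₀ : Ω → EuclideanSpace ℝ (Fin n))
    (w : ℕ → Ω → EuclideanSpace ℝ (Fin n)) (η : ℝ) : Prop where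
  eta_pos : 0 < η
  initial : psi2Norm P (fun ω => ‖x₀ ω‖) ≤ ENNReal.ofReal η
  attack : ∀ t : ℕ, CondPsi2NormLE P (attackHistory x₀ w t) (fun ω => ‖w t ω‖) η

/-- `ξ` is a sequence of independent Bernoulli(`p`) variables, each `ξ_t` is independent of `F_t`,
and there is no attack at the times with `ξ_t = 0`. -/
structure IsProbabilisticAttack {n : ℕ} (P : Measure Ω) (x₀ : Ω → EuclideanSpace ℝ (Fin n))
    (w : ℕ → Ω → EuclideanSpace ℝ (Fin n)) (ξ : ℕ → Ω → ℝ) (p : unitInterval) : Prop where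
  measurable : ∀ t, Measurable (ξ t)
  law : ∀ t, HasLaw (ξ t) (bernoulliMeasure (1 : ℝ) 0 p) P
  iIndep : iIndepFun ξ P
  indep_history : ∀ t, Indep (MeasurableSpace.comap (ξ t) inferInstance) (attackHistory x₀ w t) P
  no_attack : ∀ t, {ω | ξ t ω = 0} ⊆ {ω | w t ω = 0}

/-- The inputs `u_0, …, u_{N-1}` are independent with law `N(0, σ² I_m)`. -/
structure IsGaussianInput {m : ℕ} (P : Measure Ω) (u : ℕ → Ω → EuclideanSpace ℝ (Fin m))
    (σ : ℝ) (N : ℕ) : Prop where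
  measurable : ∀ t < N, Measurable (u t)
  law : ∀ t < N, HasLaw (u t)
    (multivariateGaussian 0 (σ ^ 2 • (1 : Matrix (Fin m) (Fin m) ℝ))) P
  iIndep : iIndepFun (fun t : Fin N => u t) P

end Probability

end SysId

end

/-!
The residual `y_t - G* U_t` of the true parameters consists of the contribution `C A^{k-1} x_{t-k+1}`
of an old state and of the attacks at the `k - 1` preceding times. Call `t` clean if these times are
attack-free (probability `1 - q > 1/2`), and let `ε_t = 1` for clean `t` and `ε_t = -1` otherwise.
If `Ĝ` is a minimizer and `Δ = G* - Ĝ`, optimality and the triangle inequality give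
`∑ ε_t ‖Δ U_t‖ ≤ 2 ∑ ‖C A^{k-1} x_{t-k+1}‖` (`SysId.sum_cleanSign_mul_norm_le`). The right-hand side
is at most a multiple of `ψ ρ^{k-1} ‖C‖ / (1 - ρ)` times `‖x₀‖ + ∑ (‖B‖ ‖u_t‖ + ‖w_t‖)`, and this sum
has the required order by Chernoff bounds (`SysId.measure_sum_norm_input_ge_le`,
`SysId.measure_sum_norm_attack_ge_le`). They use neither independence of attacks and inputs nor more
about the attacks than the conditional sub-Gaussian bound.

It remains to bound `∑ ε_t ‖Δ U_t‖` below by a multiple of `(1 - 2 q) T σ ‖Δ‖_F` for all `Δ` at once.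

* The number of rows of `Δ` plays no role: `‖Δ U‖` is proportional to the mean of `|⟪Δᵀ g, U⟫|` over
  a standard Gaussian vector `g`, so that a bound `∑ ε_t |⟪v, U_t⟫| ≥ K ‖v‖` for all vectors `v`
  implies the matrix bound with the same `K` (`SysId.mul_frobNorm_le_sum`).
* For fixed `v`, the signs are independent of the inputs, and the terms with `t` in one residue class
  modulo `k` are independent. Each term is `ε |Z|` with `Z` Gaussian and `E ε = 1 - 2 q`, and
  `E exp (-a ε |Z|) = E cosh (a Z) - (1 - 2 q) E sinh (a |Z|)` yields the lower tail bound
  `exp (-c (1 - 2 q)² T / k)` (`SysId.measure_signedSum_lt_le`).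
* A union bound over the integer points of a box in dimension `d = mk`, whose side is polynomial in
  `d / (1 - 2 q)`, extends this to all `v` (`SysId.signedSum_ge_of_intBox`). The logarithm of the
  number of points is of order `d log (d / (1 - 2 q))`, which is the price in the sample size. For
  `d = 1` this price is zero, and indeed one direction suffices
  (`SysId.signedSum_ge_of_card_eq_one`).
-/

noncomputable section

namespace SysId

/-! ### The system along attack-free windows -/

lemma specNorm_nonneg {a b : ℕ} (M : Matrix (Fin a) (Fin b) ℝ) : 0 ≤ specNorm M := norm_nonneg _

lemma norm_toEuclideanLin_le {a b : ℕ} (M : Matrix (Fin a) (Fin b) ℝ)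
    (x : EuclideanSpace ℝ (Fin b)) :
    ‖Matrix.toEuclideanLin M x‖ ≤ specNorm M * ‖x‖ :=
  (LinearMap.toContinuousLinearMap (Matrix.toEuclideanLin M)).le_opNorm x

lemma toEuclideanLin_apply_apply {a b : Type*} [Fintype b] [DecidableEq b] (M : Matrix a b ℝ)
    (x : EuclideanSpace ℝ b) (i : a) : Matrix.toEuclideanLin M x i = ∑ j, M i j * x j := rfl

lemma toEuclideanLin_mul_apply {a b c : Type*} [Fintype a] [Fintype b] [Fintype c]
    [DecidableEq a] [DecidableEq b] [DecidableEq c] (M : Matrix a b ℝ) (N : Matrix b c ℝ)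
    (x : EuclideanSpace ℝ c) :
    Matrix.toEuclideanLin (M * N) x = Matrix.toEuclideanLin M (Matrix.toEuclideanLin N x) := by
  simp [Matrix.toEuclideanLin, Matrix.toLpLin_apply, Matrix.mulVec_mulVec]

variable {n m r : ℕ}

lemma state_add_of_attack_eq_zero (A : Matrix (Fin n) (Fin n) ℝ) (B : Matrix (Fin n) (Fin m) ℝ)
    (x₀ : EuclideanSpace ℝ (Fin n)) (u : ℕ → EuclideanSpace ℝ (Fin m))
    (w : ℕ → EuclideanSpace ℝ (Fin n)) (s l : ℕ) (hw : ∀ i < l, w (s + i) = 0) :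
    state A B x₀ u w (s + l) = Matrix.toEuclideanLin (A ^ l) (state A B x₀ u w s) +
      ∑ j ∈ Finset.range l, Matrix.toEuclideanLin (A ^ j * B) (u (s + l - (j + 1))) := by
  induction l with
  | zero => simp
  | succ l ih =>
    have h : state A B x₀ u w (s + (l + 1)) = Matrix.toEuclideanLin A (state A B x₀ u w (s + l)) +
        Matrix.toEuclideanLin B (u (s + l)) + w (s + l) := rfl
    rw [h, ih fun i hi => hw i (by omega), hw l (by omega), Finset.sum_range_succ', map_add,
      map_sum, pow_succ', toEuclideanLin_mul_apply]
    simp only [pow_succ', Matrix.mul_assoc, toEuclideanLin_mul_apply, pow_zero, Matrix.one_mul]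
    have : ∀ j, s + (l + 1) - (j + 1 + 1) = s + l - (j + 1) := by intro j; omega
    simp only [this, add_zero]
    rw [add_assoc]
    simp

lemma markovMatrix_inputWindow (A : Matrix (Fin n) (Fin n) ℝ) (B : Matrix (Fin n) (Fin m) ℝ)
    (C : Matrix (Fin r) (Fin n) ℝ) (D : Matrix (Fin r) (Fin m) ℝ) (l t : ℕ)
    (u : ℕ → EuclideanSpace ℝ (Fin m)) :
    Matrix.toEuclideanLin (markovMatrix A B C D (l + 1)) (inputWindow (l + 1) u t) =
      Matrix.toEuclideanLin D (u t) + ∑ j ∈ Finset.range l,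
        Matrix.toEuclideanLin (C * (A ^ j * B)) (u (t - (j + 1))) := by
  rw [← Fin.sum_univ_eq_sum_range
    (fun j => Matrix.toEuclideanLin (C * (A ^ j * B)) (u (t - (j + 1))))]
  ext i
  simp only [PiLp.add_apply, WithLp.ofLp_sum, Finset.sum_apply, toEuclideanLin_apply_apply,
    Fintype.sum_prod_type, Fin.sum_univ_succ, markovMatrix, inputWindow, Matrix.mul_assoc]
  simp

/-- If no attack occurs at the times `s, …, s + l - 1`, the true parameters explain the observation
at time `s + l` up to the contribution of the state at time `s`. -/
lemma observation_sub_markovMatrix (A : Matrix (Fin n) (Fin n) ℝ) (B : Matrix (Fin n) (Fin m) ℝ)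
    (C : Matrix (Fin r) (Fin n) ℝ) (D : Matrix (Fin r) (Fin m) ℝ)
    (x₀ : EuclideanSpace ℝ (Fin n)) (u : ℕ → EuclideanSpace ℝ (Fin m))
    (w : ℕ → EuclideanSpace ℝ (Fin n)) (s l : ℕ) (hw : ∀ i < l, w (s + i) = 0) :
    observation A B C D x₀ u w (s + l) -
      Matrix.toEuclideanLin (markovMatrix A B C D (l + 1)) (inputWindow (l + 1) u (s + l)) =
      Matrix.toEuclideanLin C (Matrix.toEuclideanLin (A ^ l) (state A B x₀ u w s)) := by
  rw [observation, state_add_of_attack_eq_zero A B x₀ u w s l hw, markovMatrix_inputWindow, map_add,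
    map_sum]
  simp only [toEuclideanLin_mul_apply]
  abel

/-- The scalar recursion `z_{t+1} = ρ z_t + b_t` that dominates the norm of the state. -/
def stateBound (ρ a : ℝ) (b : ℕ → ℝ) : ℕ → ℝ
  | 0 => a
  | t + 1 => ρ * stateBound ρ a b t + b t

lemma stateBound_nonneg {ρ a : ℝ} {b : ℕ → ℝ} (hρ : 0 ≤ ρ) (ha : 0 ≤ a) (hb : ∀ t, 0 ≤ b t)
    (t : ℕ) : 0 ≤ stateBound ρ a b t := by
  induction t with
  | zero => exact ha
  | succ t ih => exact add_nonneg (mul_nonneg hρ ih) (hb t)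

lemma sum_stateBound (ρ a : ℝ) (b : ℕ → ℝ) (T : ℕ) :
    (1 - ρ) * ∑ s ∈ Finset.range T, stateBound ρ a b s + stateBound ρ a b T =
      a + ∑ s ∈ Finset.range T, b s := by
  induction T with
  | zero => simp [stateBound]
  | succ T ih =>
    rw [Finset.sum_range_succ, Finset.sum_range_succ, stateBound]
    linarith

lemma norm_pow_state_le {A : Matrix (Fin n) (Fin n) ℝ} {ψ ρ : ℝ} (hA : IsStable A ψ ρ)
    (B : Matrix (Fin n) (Fin m) ℝ) (x₀ : EuclideanSpace ℝ (Fin n))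
    (u : ℕ → EuclideanSpace ℝ (Fin m)) (w : ℕ → EuclideanSpace ℝ (Fin n)) (s i : ℕ) :
    ‖Matrix.toEuclideanLin (A ^ i) (state A B x₀ u w s)‖ ≤
      ψ * ρ ^ i * stateBound ρ ‖x₀‖ (fun t => specNorm B * ‖u t‖ + ‖w t‖) s := by
  induction s generalizing i with
  | zero =>
    exact (norm_toEuclideanLin_le _ _).trans
      (mul_le_mul_of_nonneg_right (hA.bound i) (norm_nonneg _))
  | succ s ih =>
    have hψρ : 0 ≤ ψ * ρ ^ i := mul_nonneg hA.psi_pos.le (pow_nonneg hA.rho_nonneg i)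
    have h1 : Matrix.toEuclideanLin (A ^ i) (state A B x₀ u w (s + 1)) =
        Matrix.toEuclideanLin (A ^ (i + 1)) (state A B x₀ u w s) +
          Matrix.toEuclideanLin (A ^ i) (Matrix.toEuclideanLin B (u s) + w s) := by
      rw [state, add_assoc, map_add, pow_succ, toEuclideanLin_mul_apply]
    have h2 : ‖Matrix.toEuclideanLin B (u s) + w s‖ ≤ specNorm B * ‖u s‖ + ‖w s‖ :=
      (norm_add_le _ _).trans (by gcongr; exact norm_toEuclideanLin_le _ _)
    have h3 := (norm_toEuclideanLin_le (A ^ i) (Matrix.toEuclideanLin B (u s) + w s)).trans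
      (mul_le_mul (hA.bound i) h2 (norm_nonneg _) hψρ)
    rw [h1, stateBound]
    refine (norm_add_le _ _).trans ((add_le_add (ih (i + 1)) h3).trans (le_of_eq ?_))
    ring

/-- `+1` if `ξ` vanishes on the window `s, …, s + l - 1`, and `-1` otherwise. -/
def cleanSign (l : ℕ) (ξ : ℕ → ℝ) (s : ℕ) : ℝ :=
  open Classical in if ∀ i < l, ξ (s + i) = 0 then 1 else -1

lemma abs_cleanSign (l : ℕ) (ξ : ℕ → ℝ) (s : ℕ) : |cleanSign l ξ s| = 1 := by
  unfold cleanSign; split_ifs <;> simp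

lemma l2Objective_succ (l T : ℕ) (u : ℕ → EuclideanSpace ℝ (Fin m))
    (y : ℕ → EuclideanSpace ℝ (Fin r)) (G : Matrix (Fin r) (Fin (l + 1) × Fin m) ℝ) :
    l2Objective (l + 1) T u y G = ∑ s ∈ Finset.range T,
      ‖y (s + l) - Matrix.toEuclideanLin G (inputWindow (l + 1) u (s + l))‖ := by
  rw [l2Objective, Finset.sum_Ico_eq_sum_range]
  have : T + (l + 1) - 1 - (l + 1 - 1) = T := by omega
  rw [this]
  refine Finset.sum_congr rfl fun s _ => ?_
  have : l + 1 - 1 + s = s + l := by omega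
  rw [this]

/-- The basic inequality of the estimator. At a time with a clean window the true parameters leave
only a small residual, so that the error `‖(G* - G) U‖` counts positively; at any other time
optimality and the triangle inequality cost at most the same quantity. -/
lemma sum_cleanSign_mul_norm_le {A : Matrix (Fin n) (Fin n) ℝ} {ψ ρ : ℝ} (hA : IsStable A ψ ρ)
    (B : Matrix (Fin n) (Fin m) ℝ) (C : Matrix (Fin r) (Fin n) ℝ) (D : Matrix (Fin r) (Fin m) ℝ)
    (x₀ : EuclideanSpace ℝ (Fin n)) (u : ℕ → EuclideanSpace ℝ (Fin m))
    (w : ℕ → EuclideanSpace ℝ (Fin n)) (ξ : ℕ → ℝ) (hξ : ∀ t, ξ t = 0 → w t = 0) (l T : ℕ)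
    (G : Matrix (Fin r) (Fin (l + 1) × Fin m) ℝ)
    (hG : IsL2Estimate (l + 1) T u (observation A B C D x₀ u w) G) :
    ∑ s ∈ Finset.range T, cleanSign l ξ s *
        ‖Matrix.toEuclideanLin (markovMatrix A B C D (l + 1) - G)
          (inputWindow (l + 1) u (s + l))‖ ≤
      2 * specNorm C * ψ * ρ ^ l *
        ∑ s ∈ Finset.range T, stateBound ρ ‖x₀‖ (fun t => specNorm B * ‖u t‖ + ‖w t‖) s := by
  have hopt := hG (markovMatrix A B C D (l + 1))
  rw [l2Objective_succ, l2Objective_succ, ← sub_nonpos, ← Finset.sum_sub_distrib] at hopt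
  rw [Finset.mul_sum, ← sub_nonpos, ← Finset.sum_sub_distrib]
  refine le_trans (Finset.sum_le_sum fun s _ => ?_) hopt
  set U := inputWindow (l + 1) u (s + l)
  set y := observation A B C D x₀ u w (s + l)
  set S := stateBound ρ ‖x₀‖ (fun t => specNorm B * ‖u t‖ + ‖w t‖) s with hS
  set R := y - Matrix.toEuclideanLin (markovMatrix A B C D (l + 1)) U with hR
  set E := Matrix.toEuclideanLin (markovMatrix A B C D (l + 1) - G) U with hE
  have h1 : y - Matrix.toEuclideanLin G U = R + E := by
    simp only [hR, hE, map_sub, LinearMap.sub_apply]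
    abel
  have hS0 : 0 ≤ 2 * specNorm C * ψ * ρ ^ l * S := by
    have := specNorm_nonneg C
    have := hA.psi_pos
    have := hA.rho_nonneg
    have : 0 ≤ S := stateBound_nonneg hA.rho_nonneg (norm_nonneg _)
      (fun t => add_nonneg (mul_nonneg (specNorm_nonneg _) (norm_nonneg _)) (norm_nonneg _)) s
    positivity
  rw [h1]
  unfold cleanSign
  split_ifs with hc
  · have hRle : ‖R‖ ≤ specNorm C * (ψ * ρ ^ l * S) := by
      rw [hR, observation_sub_markovMatrix A B C D x₀ u w s l fun i hi => hξ _ (hc i hi)]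
      exact (norm_toEuclideanLin_le _ _).trans
        (mul_le_mul_of_nonneg_left (norm_pow_state_le hA B x₀ u w s l) (specNorm_nonneg _))
    have h2 : ‖E‖ ≤ ‖R + E‖ + ‖R‖ := by
      simpa using norm_sub_le (R + E) R
    linarith
  · have h2 : ‖R‖ ≤ ‖R + E‖ + ‖E‖ := by
      simpa using norm_sub_le (R + E) E
    linarith

/-! ### Gaussian averages and the reduction to a one-dimensional output -/

lemma integrable_abs_gaussianReal : Integrable (fun x : ℝ => |x|) (gaussianReal 0 1) :=
  (IsGaussian.integrable_id (μ := gaussianReal 0 1)).abs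

/-- The first absolute moment of a standard Gaussian is at least `1 - E[cos x] = 1 - e^{-1/2}`. -/
lemma one_third_le_integral_abs : (1 : ℝ) / 3 ≤ ∫ x, |x| ∂(gaussianReal 0 1) := by
  have hint : Integrable (fun x : ℝ => Real.cos x) (gaussianReal 0 1) :=
    Integrable.of_bound (C := 1) (by fun_prop)
      (Filter.Eventually.of_forall fun x => Real.abs_cos_le_one x)
  have hcos : ∫ x, Real.cos x ∂(gaussianReal 0 1) = Real.exp (-1 / 2) := by
    have h := charFun_gaussianReal (μ := 0) (v := 1) 1
    rw [charFun_apply_real] at h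
    have h2 := congrArg Complex.re h
    rw [← RCLike.re_eq_complex_re, ← integral_re] at h2
    · have h3 : ∀ x : ℝ, RCLike.re (Complex.exp (((1 : ℝ) : ℂ) * x * Complex.I)) = Real.cos x := by
        intro x
        simp [Complex.exp_ofReal_mul_I_re]
      simp only [h3] at h2
      rw [h2, RCLike.re_eq_complex_re]
      have : (((1 : ℝ) : ℂ) * ((0 : ℝ) : ℂ) * Complex.I -
          ((1 : NNReal) : ℝ) * ((1 : ℝ) : ℂ) ^ 2 / 2) = ((-1 / 2 : ℝ) : ℂ) := by
        push_cast; ring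
      rw [this, Complex.exp_ofReal_re]
    · refine Integrable.of_bound (C := 1) (by fun_prop) (Filter.Eventually.of_forall fun x => ?_)
      simp
  have hle : ∀ x : ℝ, 1 - Real.cos x ≤ |x| := by
    intro x
    rcases le_total 2 |x| with h | h
    · linarith [Real.neg_one_le_cos x]
    · have h1 := Real.one_sub_sq_div_two_le_cos (x := x)
      nlinarith [abs_nonneg x, sq_abs x]
  have h1 : ∫ x, (1 - Real.cos x) ∂(gaussianReal 0 1) ≤ ∫ x, |x| ∂(gaussianReal 0 1) :=
    integral_mono ((integrable_const _).sub hint) integrable_abs_gaussianReal hle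
  rw [integral_sub (integrable_const _) hint, hcos] at h1
  have h2 : Real.exp (-1 / 2) ≤ 2 / 3 := by
    rw [neg_div, Real.exp_neg]
    have := Real.add_one_le_exp (1 / 2 : ℝ)
    rw [inv_le_comm₀ (Real.exp_pos _) (by norm_num)]
    linarith
  simp at h1
  linarith

lemma map_inner_stdGaussian {E : Type*} [NormedAddCommGroup E] [InnerProductSpace ℝ E]
    [FiniteDimensional ℝ E] [MeasurableSpace E] [BorelSpace E] (x : E) :
    (stdGaussian E).map (fun g => inner ℝ x g) =
      (gaussianReal 0 1).map (fun z => ‖x‖ * z) := by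
  have h := IsGaussian.map_eq_gaussianReal (μ := stdGaussian E) (innerSL ℝ x)
  rw [integral_strongDual_stdGaussian, variance_dual_stdGaussian, innerSL_apply_norm] at h
  rw [gaussianReal_map_const_mul]
  convert h using 2
  · simp
  · simp
  · rw [mul_one]
    exact (Real.toNNReal_of_nonneg (sq_nonneg _)).symm

lemma integrable_abs_inner_stdGaussian {E : Type*} [NormedAddCommGroup E] [InnerProductSpace ℝ E]
    [FiniteDimensional ℝ E] [MeasurableSpace E] [BorelSpace E] (x : E) :
    Integrable (fun g => |inner ℝ x g|) (stdGaussian E) :=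
  ((innerSL ℝ x).integrable_comp IsGaussian.integrable_id).abs

lemma integral_abs_inner_stdGaussian {E : Type*} [NormedAddCommGroup E] [InnerProductSpace ℝ E]
    [FiniteDimensional ℝ E] [MeasurableSpace E] [BorelSpace E] (x : E) :
    ∫ g, |inner ℝ x g| ∂(stdGaussian E) = (∫ z, |z| ∂(gaussianReal 0 1)) * ‖x‖ := by
  calc ∫ g, |inner ℝ x g| ∂(stdGaussian E)
      = ∫ z, |z| ∂((stdGaussian E).map (fun g => inner ℝ x g)) := by
        rw [integral_map (by fun_prop) (by fun_prop)]
    _ = ∫ z, |‖x‖ * z| ∂(gaussianReal 0 1) := by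
        rw [map_inner_stdGaussian, integral_map (by fun_prop) (by fun_prop)]
    _ = _ := by simp_rw [abs_mul, abs_norm, integral_const_mul, mul_comm]

lemma frobNorm_nonneg {ι κ : Type*} [Fintype ι] [Fintype κ] (M : Matrix ι κ ℝ) :
    0 ≤ frobNorm M := Real.sqrt_nonneg _

lemma inner_toEuclideanLin_eq {r : ℕ} {κ : Type*} [Fintype κ] [DecidableEq κ]
    (M : Matrix (Fin r) κ ℝ) (x : EuclideanSpace ℝ κ) (g : EuclideanSpace ℝ (Fin r)) :
    inner ℝ (Matrix.toEuclideanLin M x) g = inner ℝ (Matrix.toEuclideanLin M.transpose g) x := by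
  simp only [PiLp.inner_apply, toEuclideanLin_apply_apply, RCLike.inner_apply, conj_trivial,
    Matrix.transpose_apply, Finset.mul_sum]
  rw [Finset.sum_comm]
  exact Finset.sum_congr rfl fun _ _ => Finset.sum_congr rfl fun _ _ => by ring

/-- The mean of `‖Mᵀ g‖` over a standard Gaussian `g` is at least `E|z|` times the Frobenius norm:
test `Mᵀ g` against the vector of the column norms of `M`. -/
lemma mul_frobNorm_le_integral {r : ℕ} {κ : Type*} [Fintype κ] [DecidableEq κ]
    (M : Matrix (Fin r) κ ℝ) :
    (∫ z, |z| ∂(gaussianReal 0 1)) * frobNorm M ≤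
      ∫ g, ‖Matrix.toEuclideanLin M.transpose g‖ ∂(stdGaussian (EuclideanSpace ℝ (Fin r))) := by
  set c := ∫ z, |z| ∂(gaussianReal 0 1)
  set μ := stdGaussian (EuclideanSpace ℝ (Fin r))
  set a : κ → EuclideanSpace ℝ (Fin r) := fun j => WithLp.toLp 2 fun i => M i j with ha
  have hentry : ∀ g j, Matrix.toEuclideanLin M.transpose g j = inner ℝ (a j) g := by
    intro g j
    simp [toEuclideanLin_apply_apply, PiLp.inner_apply, ha, mul_comm]
  have hfrob : frobNorm M ^ 2 = ∑ j, ‖a j‖ ^ 2 := by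
    refine (Real.sq_sqrt (Finset.sum_nonneg fun _ _ => Finset.sum_nonneg fun _ _ =>
      sq_nonneg _)).trans (Finset.sum_comm.trans (Finset.sum_congr rfl fun j _ => ?_))
    rw [EuclideanSpace.real_norm_sq_eq]
  have hint : Integrable (fun g => ‖Matrix.toEuclideanLin M.transpose g‖) μ :=
    ((LinearMap.toContinuousLinearMap (Matrix.toEuclideanLin M.transpose)).integrable_comp
      IsGaussian.integrable_id).norm
  set b : EuclideanSpace ℝ κ := WithLp.toLp 2 fun j => ‖a j‖ with hb
  have hbn : ‖b‖ = frobNorm M := by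
    have : ‖b‖ ^ 2 = frobNorm M ^ 2 := by
      rw [hfrob, EuclideanSpace.real_norm_sq_eq]
    exact (pow_left_inj₀ (norm_nonneg _) (frobNorm_nonneg _) two_ne_zero).1 this
  have hpt : ∀ g, ∑ j, ‖a j‖ * |inner ℝ (a j) g| ≤
      frobNorm M * ‖Matrix.toEuclideanLin M.transpose g‖ := by
    intro g
    set y : EuclideanSpace ℝ κ := WithLp.toLp 2 fun j => |inner ℝ (a j) g| with hy
    have h1 : ‖y‖ = ‖Matrix.toEuclideanLin M.transpose g‖ := by
      rw [EuclideanSpace.norm_eq, EuclideanSpace.norm_eq]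
      simp [hy, hentry]
    have h2 := real_inner_le_norm b y
    rw [h1, hbn] at h2
    refine le_trans (le_of_eq ?_) h2
    simp [PiLp.inner_apply, hb, hy, mul_comm]
  have hle := integral_mono (μ := μ)
    (integrable_finsetSum _ fun j _ => (integrable_abs_inner_stdGaussian (a j)).const_mul ‖a j‖)
    (hint.const_mul (frobNorm M)) hpt
  rw [integral_finsetSum _ fun j _ => (integrable_abs_inner_stdGaussian (a j)).const_mul ‖a j‖,
    integral_const_mul] at hle
  simp_rw [integral_const_mul, μ, integral_abs_inner_stdGaussian] at hle
  have hsum : ∑ j, ‖a j‖ * (c * ‖a j‖) = c * frobNorm M ^ 2 := by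
    rw [hfrob, Finset.mul_sum]
    exact Finset.sum_congr rfl fun _ _ => by ring
  rw [hsum] at hle
  rcases (frobNorm_nonneg M).eq_or_lt with h0 | h0
  · rw [← h0, mul_zero]
    exact integral_nonneg fun _ => norm_nonneg _
  · refine le_of_mul_le_mul_left ?_ h0
    linarith

/-- A lower bound for signed sums of `|⟪v, U_s⟫|`, uniform in the vector `v`, passes with the same
constant to the signed sums of `‖M U_s‖` for matrices with any number of rows, because
`‖M U‖` is proportional to the average of `|⟪Mᵀ g, U⟫|` over a standard Gaussian `g`. -/
lemma mul_frobNorm_le_sum {r : ℕ} {κ : Type*} [Fintype κ] [DecidableEq κ] {K : ℝ} (hK : 0 ≤ K)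
    (T : ℕ) (e : ℕ → ℝ) (U : ℕ → EuclideanSpace ℝ κ)
    (h : ∀ v, K * ‖v‖ ≤ ∑ s ∈ Finset.range T, e s * |inner ℝ v (U s)|)
    (M : Matrix (Fin r) κ ℝ) :
    K * frobNorm M ≤ ∑ s ∈ Finset.range T, e s * ‖Matrix.toEuclideanLin M (U s)‖ := by
  set c := ∫ z, |z| ∂(gaussianReal 0 1)
  have hc : 0 < c := lt_of_lt_of_le (by norm_num) one_third_le_integral_abs
  have hint : Integrable (fun g => ‖Matrix.toEuclideanLin M.transpose g‖)
      (stdGaussian (EuclideanSpace ℝ (Fin r))) :=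
    ((LinearMap.toContinuousLinearMap (Matrix.toEuclideanLin M.transpose)).integrable_comp
      IsGaussian.integrable_id).norm
  have hi : ∀ s, Integrable (fun g => e s * |inner ℝ (Matrix.toEuclideanLin M (U s)) g|)
      (stdGaussian (EuclideanSpace ℝ (Fin r))) := fun s =>
    (integrable_abs_inner_stdGaussian _).const_mul _
  have h1 := integral_mono (hint.const_mul K) (integrable_finsetSum (Finset.range T) fun s _ => hi s)
    (fun g => by
      have := h (Matrix.toEuclideanLin M.transpose g)
      simpa only [inner_toEuclideanLin_eq] using this)
  rw [integral_const_mul, integral_finsetSum _ fun s _ => hi s] at h1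
  simp_rw [integral_const_mul, integral_abs_inner_stdGaussian] at h1
  have h2 := mul_le_mul_of_nonneg_left (mul_frobNorm_le_integral M) hK
  refine le_of_mul_le_mul_left ?_ hc
  calc c * (K * frobNorm M) = K * (c * frobNorm M) := by ring
    _ ≤ _ := h2.trans h1
    _ = _ := by
      rw [Finset.mul_sum]
      exact Finset.sum_congr rfl fun _ _ => by ring

/-! ### Reduction of a bound for all directions to finitely many directions -/

/-- The signed sum `∑_{s < T} e_s |⟪v, U_s⟫|`. -/
def signedSum {κ : Type*} [Fintype κ] (T : ℕ) (e : ℕ → ℝ) (U : ℕ → EuclideanSpace ℝ κ)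
    (v : EuclideanSpace ℝ κ) : ℝ :=
  ∑ s ∈ Finset.range T, e s * |inner ℝ v (U s)|

/-- An integer vector as an element of Euclidean space. -/
def intVec {κ : Type*} (z : κ → ℤ) : EuclideanSpace ℝ κ := WithLp.toLp 2 fun i => (z i : ℝ)

/-- The integer vectors whose entries are at most `M` in absolute value. -/
def intBox (κ : Type*) [Fintype κ] [DecidableEq κ] (M : ℕ) : Finset (κ → ℤ) :=
  Fintype.piFinset fun _ => Finset.Icc (-(M : ℤ)) M

section

variable {κ : Type*} [Fintype κ]

lemma signedSum_smul (T : ℕ) (e : ℕ → ℝ) (U : ℕ → EuclideanSpace ℝ κ) (a : ℝ)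
    (v : EuclideanSpace ℝ κ) : signedSum T e U (a • v) = |a| * signedSum T e U v := by
  simp only [signedSum, Finset.mul_sum, real_inner_smul_left, abs_mul]
  exact Finset.sum_congr rfl fun _ _ => by ring

lemma signedSum_sub_le {T : ℕ} {e : ℕ → ℝ} {U : ℕ → EuclideanSpace ℝ κ} (he : ∀ s, |e s| ≤ 1)
    (v v' : EuclideanSpace ℝ κ) :
    signedSum T e U v' - signedSum T e U v ≤
      ‖v - v'‖ * ∑ s ∈ Finset.range T, ‖U s‖ := by
  rw [signedSum, signedSum, ← Finset.sum_sub_distrib, Finset.mul_sum]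
  refine Finset.sum_le_sum fun s _ => ?_
  have h1 : |(|inner ℝ v' (U s)| - |inner ℝ v (U s)|)| ≤ ‖v - v'‖ * ‖U s‖ := by
    refine (abs_abs_sub_abs_le _ _).trans ?_
    rw [← inner_sub_left, ← norm_neg (v - v'), neg_sub]
    exact abs_real_inner_le_norm _ _
  rw [← mul_sub]
  refine (le_abs_self _).trans ?_
  rw [abs_mul]
  calc |e s| * _ ≤ 1 * (‖v - v'‖ * ‖U s‖) := mul_le_mul (he s) h1 (abs_nonneg _) zero_le_one
    _ = _ := one_mul _

lemma card_intBox [DecidableEq κ] (M : ℕ) :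
    (intBox κ M).card = (2 * M + 1) ^ Fintype.card κ := by
  rw [intBox, Fintype.card_piFinset, Finset.prod_const, Int.card_Icc, Finset.card_univ]
  congr 1
  omega

/-- If the signed sum is bounded below on the integer vectors of a large box, it is bounded
below, with half the constant, everywhere: scale `v` to length `M` and round down its entries. -/
lemma signedSum_ge_of_intBox [DecidableEq κ] {T M : ℕ} {e : ℕ → ℝ} {U : ℕ → EuclideanSpace ℝ κ}
    {K R : ℝ} (he : ∀ s, |e s| ≤ 1) (hK : 0 ≤ K) (hR : ∑ s ∈ Finset.range T, ‖U s‖ ≤ R)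
    (hM0 : 0 < M) (hM : 2 * √(Fintype.card κ) * (K + R) ≤ K * M)
    (h : ∀ z ∈ intBox κ M, K * ‖intVec z‖ ≤ signedSum T e U (intVec z))
    (v : EuclideanSpace ℝ κ) : K / 2 * ‖v‖ ≤ signedSum T e U v := by
  rcases eq_or_ne v 0 with rfl | hv
  · simp [signedSum]
  have hv0 : 0 < ‖v‖ := norm_pos_iff.2 hv
  have hMr : (0 : ℝ) < M := by exact_mod_cast hM0
  set a : ℝ := M / ‖v‖ with ha
  have ha0 : 0 < a := div_pos hMr hv0
  set y := a • v with hy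
  have hyn : ‖y‖ = M := by
    rw [hy, norm_smul, Real.norm_of_nonneg ha0.le, ha, div_mul_cancel₀ _ hv0.ne']
  set z : κ → ℤ := fun i => ⌊y i⌋ with hz
  have hzmem : z ∈ intBox κ M := by
    rw [intBox, Fintype.mem_piFinset]
    intro i
    have hi : |y i| ≤ M := by
      have := PiLp.norm_apply_le y i
      rwa [hyn] at this
    rw [abs_le] at hi
    rw [Finset.mem_Icc]
    refine ⟨Int.le_floor.2 (by push_cast; exact hi.1), ?_⟩
    have : (⌊y i⌋ : ℝ) ≤ ((M : ℤ) : ℝ) := (Int.floor_le _).trans (by exact_mod_cast hi.2)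
    exact_mod_cast this
  have hdist : ‖y - intVec z‖ ≤ √(Fintype.card κ) := by
    rw [EuclideanSpace.norm_eq]
    refine Real.sqrt_le_sqrt ?_
    calc ∑ i, ‖(y - intVec z) i‖ ^ 2 ≤ ∑ _i : κ, (1 : ℝ) := by
          refine Finset.sum_le_sum fun i _ => ?_
          have h1 : (y - intVec z) i = Int.fract (y i) := rfl
          rw [h1, Real.norm_of_nonneg (Int.fract_nonneg _)]
          exact pow_le_one₀ (Int.fract_nonneg _) (Int.fract_lt_one _).le
      _ = Fintype.card κ := by simp
  have hR0 : 0 ≤ ∑ s ∈ Finset.range T, ‖U s‖ := Finset.sum_nonneg fun _ _ => norm_nonneg _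
  have h1 := signedSum_sub_le he (T := T) (U := U) y (intVec z)
  have h2 : ‖y - intVec z‖ * ∑ s ∈ Finset.range T, ‖U s‖ ≤ √(Fintype.card κ) * R :=
    mul_le_mul hdist hR hR0 (Real.sqrt_nonneg _)
  have h3 : (M : ℝ) - √(Fintype.card κ) ≤ ‖intVec z‖ := by
    have := norm_sub_norm_le y (intVec z)
    linarith
  have h4 := (mul_le_mul_of_nonneg_left h3 hK).trans (h z hzmem)
  have h5 : K / 2 * M ≤ signedSum T e U y := by nlinarith
  rw [hy, signedSum_smul, abs_of_pos ha0] at h5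
  refine le_of_mul_le_mul_left ?_ ha0
  calc a * (K / 2 * ‖v‖) = K / 2 * M := by rw [ha]; field_simp
    _ ≤ _ := h5

/-- In dimension one a single direction suffices. -/
lemma signedSum_ge_of_card_eq_one {T : ℕ} {e : ℕ → ℝ} {U : ℕ → EuclideanSpace ℝ κ} {K : ℝ}
    (hκ : Fintype.card κ = 1)
    (h : K * ‖intVec (fun _ : κ => 1)‖ ≤ signedSum T e U (intVec fun _ => 1))
    (v : EuclideanSpace ℝ κ) : K * ‖v‖ ≤ signedSum T e U v := by
  obtain ⟨i, hi⟩ := Fintype.card_eq_one_iff.1 hκ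
  have hv : v = v i • intVec (fun _ : κ => 1) := by
    ext j
    rw [hi j]
    simp [intVec]
  rw [hv, signedSum_smul, norm_smul, Real.norm_eq_abs]
  calc K * (|v i| * _) = |v i| * (K * ‖intVec (fun _ : κ => 1)‖) := by ring
    _ ≤ _ := mul_le_mul_of_nonneg_left h (abs_nonneg _)

end

/-! ### Tail bounds for sums of sub-Gaussian norms -/

/-- Integrated form of the conditional sub-Gaussian bound. -/
lemma lintegral_mul_exp_le {Ω : Type*} {F mΩ : MeasurableSpace Ω} {P : Measure[mΩ] Ω}
    [IsProbabilityMeasure P] (hF : F ≤ mΩ) {X : Ω → ℝ} (hX : Measurable[mΩ] X) {η : ℝ}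
    (h : CondPsi2NormLE P F X η) {f : Ω → ENNReal} (hf : Measurable[F] f) :
    ∫⁻ ω, f ω * ENNReal.ofReal (Real.exp (X ω ^ 2 / η ^ 2)) ∂P ≤ 2 * ∫⁻ ω, f ω ∂P := by
  set g : Ω → ENNReal := fun ω => ENNReal.ofReal (Real.exp (X ω ^ 2 / η ^ 2)) with hg
  have hgm : Measurable g := by fun_prop
  have hle : (P.withDensity g).trim hF ≤ (2 : ENNReal) • P.trim hF := by
    refine Measure.le_iff.2 fun A hA => ?_
    rw [trim_measurableSet_eq hF hA, withDensity_apply _ (hF A hA), Measure.smul_apply,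
      trim_measurableSet_eq hF hA, smul_eq_mul, hg,
      ← ofReal_integral_eq_lintegral_ofReal h.1.integrableOn
        (Filter.Eventually.of_forall fun _ => (Real.exp_pos _).le),
      ← setIntegral_condExp hF h.1 hA]
    have h2 : ∫ ω in A, (P[fun ω => Real.exp (X ω ^ 2 / η ^ 2) | F]) ω ∂P ≤ ∫ _ω in A, 2 ∂P :=
      setIntegral_mono_ae integrable_condExp.integrableOn (by simp) h.2
    rw [setIntegral_const, smul_eq_mul] at h2
    refine (ENNReal.ofReal_le_ofReal h2).trans (le_of_eq ?_)
    rw [ENNReal.ofReal_mul measureReal_nonneg, ofReal_measureReal, mul_comm]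
    simp
  calc ∫⁻ ω, f ω * g ω ∂P = ∫⁻ ω, f ω ∂(P.withDensity g) := by
        rw [lintegral_withDensity_eq_lintegral_mul _ hgm (hf.mono hF le_rfl)]
        exact lintegral_congr fun ω => mul_comm _ _
    _ = ∫⁻ ω, f ω ∂((P.withDensity g).trim hF) := (lintegral_trim hF hf).symm
    _ ≤ ∫⁻ ω, f ω ∂((2 : ENNReal) • P.trim hF) := lintegral_mono' hle le_rfl
    _ = 2 * ∫⁻ ω, f ω ∂P := by rw [lintegral_smul_measure, lintegral_trim hF hf, smul_eq_mul]

section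

variable {Ω : Type*} [MeasurableSpace Ω]

/-- Chernoff's bound for variables with `E ∏ exp (X_i²) ≤ 2 ^ #S`, from `X ≤ X² + 1/4`. -/
lemma measure_sum_ge_le (P : Measure Ω) {ι : Type*} (S : Finset ι) (X : ι → Ω → ℝ)
    (hX : ∀ i ∈ S, Measurable (X i))
    (h : ∫⁻ ω, ∏ i ∈ S, ENNReal.ofReal (Real.exp (X i ω ^ 2)) ∂P ≤ 2 ^ S.card) :
    P {ω | 11 * (S.card : ℝ) ≤ ∑ i ∈ S, X i ω} ≤
      ENNReal.ofReal (Real.exp (-10 * S.card)) := by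
  set N : ℝ := (S.card : ℝ)
  have hexp : 2 ≤ Real.exp (3 / 4) := by
    have := Real.quadratic_le_exp_of_nonneg (x := 3 / 4) (by norm_num)
    linarith
  have hsub : {ω | 11 * N ≤ ∑ i ∈ S, X i ω} ⊆
      {ω | ENNReal.ofReal (Real.exp (43 / 4 * N)) ≤
        ∏ i ∈ S, ENNReal.ofReal (Real.exp (X i ω ^ 2))} := by
    intro ω hω
    have h1 : ∑ i ∈ S, X i ω ≤ ∑ i ∈ S, (X i ω ^ 2 + 1 / 4) :=
      Finset.sum_le_sum fun i _ => by nlinarith [sq_nonneg (X i ω - 1 / 2)]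
    rw [Finset.sum_add_distrib, Finset.sum_const, nsmul_eq_mul] at h1
    change 11 * N ≤ _ at hω
    rw [Set.mem_ofPred_eq, ← ENNReal.ofReal_prod_of_nonneg fun _ _ => (Real.exp_pos _).le, ← Real.exp_sum]
    refine ENNReal.ofReal_le_ofReal (Real.exp_le_exp.2 ?_)
    change _ ≤ _ + N * _ at h1
    linarith
  have hmarkov := mul_meas_ge_le_lintegral₀ (μ := P)
    (Finset.aemeasurable_fun_prod S fun i hi =>
      ((Real.measurable_exp.comp ((hX i hi).pow_const 2)).ennreal_ofReal).aemeasurable)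
    (ENNReal.ofReal (Real.exp (43 / 4 * N)))
  have hE : ENNReal.ofReal (Real.exp (43 / 4 * N)) ≠ 0 := by simp [Real.exp_pos]
  have h2 : P {ω | 11 * N ≤ ∑ i ∈ S, X i ω} ≤
      2 ^ S.card / ENNReal.ofReal (Real.exp (43 / 4 * N)) := by
    rw [ENNReal.le_div_iff_mul_le (Or.inl hE) (Or.inl ENNReal.ofReal_ne_top), mul_comm]
    exact (mul_le_mul_right (measure_mono hsub) _).trans (hmarkov.trans h)
  refine h2.trans (ENNReal.div_le_of_le_mul ?_)
  rw [← ENNReal.ofReal_mul (Real.exp_pos _).le, ← Real.exp_add]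
  have h3 : (2 : ENNReal) ^ S.card = ENNReal.ofReal (2 ^ S.card) := by
    rw [ENNReal.ofReal_pow (by norm_num)]; simp
  rw [h3]
  refine ENNReal.ofReal_le_ofReal ?_
  calc (2 : ℝ) ^ S.card ≤ Real.exp (3 / 4) ^ S.card := by gcongr
    _ = Real.exp (-10 * N + 43 / 4 * N) := by
      rw [← Real.exp_nat_mul]
      congr 1
      change N * _ = _
      ring

lemma lintegral_exp_sq_gaussianReal :
    ∫⁻ x, ENNReal.ofReal (Real.exp (x ^ 2 / 4)) ∂(gaussianReal 0 1) ≤ 2 := by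
  rw [gaussianReal_of_var_ne_zero 0 one_ne_zero,
    lintegral_withDensity_eq_lintegral_mul _ (measurable_gaussianPDF 0 1) (by fun_prop)]
  have h1 : ∀ x : ℝ, (gaussianPDF 0 1 * fun x => ENNReal.ofReal (Real.exp (x ^ 2 / 4))) x =
      ENNReal.ofReal ((√(2 * Real.pi))⁻¹ * Real.exp (-(1 / 4) * x ^ 2)) := by
    intro x
    rw [Pi.mul_apply, gaussianPDF, ← ENNReal.ofReal_mul (gaussianPDFReal_nonneg _ _ _),
      gaussianPDFReal]
    congr 1
    rw [mul_assoc, ← Real.exp_add]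
    congr 2
    · simp
    · simp; ring
  simp_rw [h1]
  rw [← ofReal_integral_eq_lintegral_ofReal
    ((integrable_exp_neg_mul_sq (by norm_num : (0 : ℝ) < 1 / 4)).const_mul _)
    (Filter.Eventually.of_forall fun x => by positivity), integral_const_mul, integral_gaussian]
  rw [show (2 : ENNReal) = ENNReal.ofReal 2 by simp]
  refine ENNReal.ofReal_le_ofReal ?_
  rw [inv_mul_le_iff₀ (by positivity), show (2 : ℝ) = √4 by
    rw [show (4 : ℝ) = 2 ^ 2 by norm_num, Real.sqrt_sq (by norm_num)],
    ← Real.sqrt_mul (by positivity)]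
  refine Real.sqrt_le_sqrt ?_
  rw [show (√4 : ℝ) = 2 by
    rw [show (4 : ℝ) = 2 ^ 2 by norm_num, Real.sqrt_sq (by norm_num)]]
  linarith [Real.pi_pos]

lemma multivariateGaussian_smul_one (m : ℕ) (σ : ℝ) :
    multivariateGaussian 0 (σ ^ 2 • (1 : Matrix (Fin m) (Fin m) ℝ)) =
      (stdGaussian (EuclideanSpace ℝ (Fin m))).map (fun g => σ • g) := by
  have hS : (σ ^ 2 • (1 : Matrix (Fin m) (Fin m) ℝ)).PosSemidef :=
    Matrix.PosSemidef.one.smul (sq_nonneg σ)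
  have : IsProbabilityMeasure
      ((stdGaussian (EuclideanSpace ℝ (Fin m))).map (fun g => σ • g)) :=
    Measure.isProbabilityMeasure_map (by fun_prop)
  refine Measure.ext_of_charFun (funext fun t => ?_)
  rw [charFun_multivariateGaussian hS, charFun_map_smul, charFun_stdGaussian, norm_smul,
    Matrix.smul_mulVec, Matrix.one_mulVec, dotProduct_smul]
  congr 1
  have : (t.ofLp ⬝ᵥ t.ofLp) = ‖t‖ ^ 2 := by
    rw [EuclideanSpace.real_norm_sq_eq]
    simp [dotProduct, sq]
  rw [this]
  simp [mul_pow, neg_div, ← Complex.ofReal_pow]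

lemma lintegral_exp_sq_norm_stdGaussian {m : ℕ} (hm : 0 < m) :
    ∫⁻ g, ENNReal.ofReal (Real.exp ((‖g‖ / (2 * √m)) ^ 2))
      ∂(stdGaussian (EuclideanSpace ℝ (Fin m))) ≤ 2 := by
  have hm' : (0 : ℝ) < m := by exact_mod_cast hm
  -- convexity of `exp` reduces the norm to the coordinates
  have h1 : ∀ g : EuclideanSpace ℝ (Fin m), ENNReal.ofReal (Real.exp ((‖g‖ / (2 * √m)) ^ 2)) ≤
      ∑ i, ENNReal.ofReal (m : ℝ)⁻¹ * ENNReal.ofReal (Real.exp (g i ^ 2 / 4)) := by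
    intro g
    have h := convexOn_exp.map_sum_le (t := (Finset.univ : Finset (Fin m)))
      (w := fun _ => (m : ℝ)⁻¹) (p := fun i => g i ^ 2 / 4) (fun _ _ => by positivity)
      (by simp [hm'.ne']) (fun _ _ => Set.mem_univ _)
    have h2 : (‖g‖ / (2 * √m)) ^ 2 = ∑ i, (m : ℝ)⁻¹ • (g i ^ 2 / 4) := by
      rw [div_pow, mul_pow, Real.sq_sqrt hm'.le, EuclideanSpace.real_norm_sq_eq, Finset.sum_div]
      refine Finset.sum_congr rfl fun i _ => ?_
      rw [smul_eq_mul]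
      field_simp
      norm_num
    rw [← h2] at h
    simp_rw [← ENNReal.ofReal_mul (inv_nonneg.2 hm'.le)]
    rw [← ENNReal.ofReal_sum_of_nonneg fun _ _ => by positivity]
    exact ENNReal.ofReal_le_ofReal h
  have hcoord : ∀ i : Fin m, ∫⁻ g, ENNReal.ofReal (Real.exp (g i ^ 2 / 4))
      ∂(stdGaussian (EuclideanSpace ℝ (Fin m))) ≤ 2 := by
    intro i
    have hlaw := map_inner_stdGaussian (EuclideanSpace.single i (1 : ℝ))
    have h0 : ∀ g : EuclideanSpace ℝ (Fin m), g i = inner ℝ (EuclideanSpace.single i (1 : ℝ)) g := by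
      intro g; simp [EuclideanSpace.inner_single_left]
    simp_rw [h0]
    rw [← lintegral_map (f := fun x : ℝ => ENNReal.ofReal (Real.exp (x ^ 2 / 4)))
      (by fun_prop) (by fun_prop), hlaw]
    simpa using lintegral_exp_sq_gaussianReal
  refine (lintegral_mono h1).trans ?_
  rw [lintegral_finsetSum _ fun i _ => by fun_prop]
  have h3 : ∀ i : Fin m, ∫⁻ g, ENNReal.ofReal (m : ℝ)⁻¹ * ENNReal.ofReal (Real.exp (g i ^ 2 / 4))
      ∂(stdGaussian (EuclideanSpace ℝ (Fin m))) ≤ ENNReal.ofReal (m : ℝ)⁻¹ * 2 := by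
    intro i
    rw [lintegral_const_mul _ (by fun_prop)]
    exact mul_le_mul_right (hcoord i) _
  refine (Finset.sum_le_sum fun i _ => h3 i).trans (le_of_eq ?_)
  rw [Finset.sum_const, Finset.card_univ, Fintype.card_fin, nsmul_eq_mul, ← mul_assoc,
    ← ENNReal.ofReal_natCast, ← ENNReal.ofReal_mul hm'.le, mul_inv_cancel₀ hm'.ne']
  simp

lemma measure_sum_norm_input_ge_le {P : Measure Ω} {m N : ℕ} (hm : 0 < m)
    {u : ℕ → Ω → EuclideanSpace ℝ (Fin m)} {σ : ℝ} (hσ : 0 < σ) (hu : IsGaussianInput P u σ N) :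
    P {ω | 22 * (σ * √m) * N ≤ ∑ s ∈ Finset.range N, ‖u s ω‖} ≤
      ENNReal.ofReal (Real.exp (-10 * N)) := by
  have hm' : (0 : ℝ) < √m := Real.sqrt_pos.2 (by exact_mod_cast hm)
  have hmeas : ∀ i : Fin N, Measurable (u i) := fun i => hu.measurable i i.2
  set X : Fin N → Ω → ℝ := fun i ω => ‖u i ω‖ / (2 * (σ * √m)) with hX
  have hXm : ∀ i, Measurable (X i) := fun i => (hmeas i).norm.div_const _
  have hone : ∀ i, ∫⁻ ω, ENNReal.ofReal (Real.exp (X i ω ^ 2)) ∂P ≤ 2 := by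
    intro i
    have hlaw := (hu.law i i.2).map_eq
    rw [multivariateGaussian_smul_one] at hlaw
    have : ∫⁻ ω, ENNReal.ofReal (Real.exp (X i ω ^ 2)) ∂P =
        ∫⁻ x, ENNReal.ofReal (Real.exp ((‖x‖ / (2 * (σ * √m))) ^ 2)) ∂(P.map (u i)) := by
      rw [lintegral_map (by fun_prop) (hmeas i)]
    rw [this, hlaw, lintegral_map (by fun_prop) (by fun_prop)]
    refine le_trans (le_of_eq ?_) (lintegral_exp_sq_norm_stdGaussian hm)
    refine lintegral_congr fun g => ?_
    rw [norm_smul, Real.norm_of_nonneg hσ.le]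
    congr 3
    field_simp
  have hind : iIndepFun (fun i ω => ENNReal.ofReal (Real.exp (X i ω ^ 2))) P :=
    hu.iIndep.comp (fun _ x => ENNReal.ofReal (Real.exp ((‖x‖ / (2 * (σ * √m))) ^ 2)))
      fun _ => by fun_prop
  have h := measure_sum_ge_le P (Finset.univ : Finset (Fin N)) X (fun i _ => hXm i) (by
    rw [lintegral_prod_eq_prod_lintegral_of_indepFun _ _ hind fun i => by
      have := hXm i; fun_prop]
    exact (Finset.prod_le_prod' fun i _ => hone i).trans (by simp))
  rw [Finset.card_univ, Fintype.card_fin] at h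
  refine le_trans (measure_mono fun ω hω => ?_) h
  rw [Set.mem_ofPred_eq] at hω ⊢
  rw [hX, ← Finset.sum_div, le_div_iff₀ (by positivity),
    Fin.sum_univ_eq_sum_range (fun s => ‖u s ω‖)]
  linarith

lemma measure_sum_norm_attack_ge_le {P : Measure Ω} [IsProbabilityMeasure P] {n : ℕ}
    {x₀ : Ω → EuclideanSpace ℝ (Fin n)} {w : ℕ → Ω → EuclideanSpace ℝ (Fin n)} {η : ℝ}
    (hx₀ : Measurable x₀) (hw : ∀ t, Measurable (w t)) (h : IsSubGaussianAttack P x₀ w η) (T : ℕ) :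
    P {ω | 22 * η * (T + 1 : ℕ) ≤ ‖x₀ ω‖ + ∑ s ∈ Finset.range T, ‖w s ω‖} ≤
      ENNReal.ofReal (Real.exp (-10 * (T + 1 : ℕ))) := by
  have hη := h.eta_pos
  have hF : ∀ t, attackHistory x₀ w t ≤ ‹MeasurableSpace Ω› := fun t =>
    sup_le hx₀.comap_le (iSup_le fun s => (hw s).comap_le)
  have hx₀F : ∀ t, Measurable[attackHistory x₀ w t] x₀ := fun t =>
    Measurable.of_comap_le le_sup_left
  have hwF : ∀ t, ∀ s < t, Measurable[attackHistory x₀ w t] (w s) := fun t s hs =>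
    Measurable.of_comap_le ((le_iSup (fun s : Fin t =>
      MeasurableSpace.comap (w s) inferInstance) ⟨s, hs⟩).trans le_sup_right)
  set X : ℕ → Ω → ℝ := fun i ω => Nat.casesOn i (‖x₀ ω‖ / (2 * η)) fun s => ‖w s ω‖ / (2 * η)
    with hX
  -- a radius below `2 η` satisfies the inequality that defines the `ψ₂`-norm of `‖x₀‖`
  have h0 : ∫⁻ ω, ENNReal.ofReal (Real.exp (X 0 ω ^ 2)) ∂P ≤ 2 := by
    have hlt : psi2Norm P (fun ω => ‖x₀ ω‖) < ENNReal.ofReal (2 * η) :=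
      h.initial.trans_lt ((ENNReal.ofReal_lt_ofReal_iff (by linarith)).2 (by linarith))
    obtain ⟨_, ⟨t, ⟨ht, hti⟩, rfl⟩, htl⟩ := sInf_lt_iff.1 hlt
    have htη : t ≤ 2 * η := ((ENNReal.ofReal_lt_ofReal_iff (by linarith)).1 htl).le
    refine le_trans (lintegral_mono fun ω => ?_) hti
    refine ENNReal.ofReal_le_ofReal (Real.exp_le_exp.2 ?_)
    change (‖x₀ ω‖ / (2 * η)) ^ 2 ≤ _
    rw [div_pow]
    gcongr
  have hdiv : Measurable fun x : EuclideanSpace ℝ (Fin n) => ‖x‖ / (2 * η) := by fun_prop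
  have hprod : ∀ t, ∫⁻ ω, ∏ i ∈ Finset.range (t + 1), ENNReal.ofReal (Real.exp (X i ω ^ 2)) ∂P ≤
      2 ^ (t + 1) := by
    intro t
    induction t with
    | zero => simpa using h0
    | succ t ih =>
      have hmeas : Measurable[attackHistory x₀ w t] fun ω =>
          ∏ i ∈ Finset.range (t + 1), ENNReal.ofReal (Real.exp (X i ω ^ 2)) := by
        refine Finset.measurable_fun_prod _ fun i hi => ?_
        have hXi : Measurable[attackHistory x₀ w t] (X i) := by
          cases i with
          | zero => exact hdiv.comp (hx₀F t)
          | succ s => exact hdiv.comp (hwF t s (by simpa using hi))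
        have hexp : Measurable fun x : ℝ => ENNReal.ofReal (Real.exp (x ^ 2)) := by fun_prop
        exact hexp.comp hXi
      have h1 := lintegral_mul_exp_le (hF t) (hw t).norm (h.attack t) hmeas
      calc _ ≤ _ := lintegral_mono fun ω => ?_
        _ ≤ _ := h1
        _ ≤ 2 * 2 ^ (t + 1) := mul_le_mul_right ih _
        _ = 2 ^ (t + 1 + 1) := (pow_succ' _ _).symm
      rw [Finset.prod_range_succ]
      refine mul_le_mul_right (ENNReal.ofReal_le_ofReal (Real.exp_le_exp.2 ?_)) _
      change (‖w t ω‖ / (2 * η)) ^ 2 ≤ _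
      rw [div_pow]
      gcongr
      linarith
  have hXm : ∀ i, Measurable (X i) := by
    intro i
    cases i with
    | zero => exact hx₀.norm.div_const _
    | succ s => exact (hw s).norm.div_const _
  have h2 := measure_sum_ge_le P (Finset.range (T + 1)) X (fun i _ => hXm i)
    (by simpa using hprod T)
  rw [Finset.card_range] at h2
  refine le_trans (measure_mono fun ω hω => ?_) h2
  rw [Set.mem_ofPred_eq] at hω ⊢
  rw [Finset.sum_range_succ']
  change _ ≤ ∑ s ∈ Finset.range T, ‖w s ω‖ / (2 * η) + ‖x₀ ω‖ / (2 * η)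
  rw [← Finset.sum_div, ← add_div, le_div_iff₀ (by positivity)]
  linarith

end

/-! ### Independence of blocks and the moment generating function of a signed Gaussian -/

section

variable {Ω : Type*} [MeasurableSpace Ω] {P : Measure Ω}

/-- Nonnegative functions of disjoint blocks of an independent family of σ-algebras are
multiplicative in expectation. -/
lemma lintegral_prod_of_disjoint_blocks [IsProbabilityMeasure P] {ι κ : Type*}
    {M : ι → MeasurableSpace Ω} (hle : ∀ i, M i ≤ ‹MeasurableSpace Ω›) (hM : iIndep M P)
    (I : κ → Set ι) (S : Finset κ)
    (hI : ∀ s ∈ S, ∀ s' ∈ S, s ≠ s' → Disjoint (I s) (I s')) (f : κ → Ω → ENNReal)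
    (hf : ∀ s ∈ S, Measurable[⨆ i ∈ I s, M i] (f s)) :
    ∫⁻ ω, ∏ s ∈ S, f s ω ∂P = ∏ s ∈ S, ∫⁻ ω, f s ω ∂P := by
  induction S using Finset.cons_induction with
  | empty => simp
  | cons a S ha ih =>
    simp only [Finset.prod_cons]
    rw [← ih (fun s hs s' hs' => hI s (Finset.mem_cons_of_mem hs) s' (Finset.mem_cons_of_mem hs'))
      fun s hs => hf s (Finset.mem_cons_of_mem hs)]
    have hdisj : Disjoint (I a) (⋃ s ∈ S, I s) := by
      rw [Set.disjoint_iUnion₂_right]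
      intro s hs
      exact hI a (Finset.mem_cons_self a S) s (Finset.mem_cons_of_mem hs)
        fun h => ha (h ▸ hs)
    refine lintegral_mul_eq_lintegral_mul_lintegral_of_independent_measurableSpace
      (iSup₂_le fun i _ => hle i) (iSup₂_le fun i _ => hle i)
      (indep_iSup_of_disjoint hle hM hdisj) (hf a (Finset.mem_cons_self a S)) ?_
    refine Finset.measurable_fun_prod _ fun s hs => ?_
    refine (hf s (Finset.mem_cons_of_mem hs)).mono (iSup₂_le fun i hi => ?_) le_rfl
    exact le_iSup₂ (f := fun i (_ : i ∈ ⋃ s ∈ S, I s) => M i) i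
      (Set.mem_biUnion (Finset.mem_coe.2 hs) hi)

/-- Two independent families of independent variables may be paired. -/
lemma iIndepFun_prodMk [IsProbabilityMeasure P] {ι α β : Type*} [Fintype ι] [MeasurableSpace α]
    [MeasurableSpace β] {X : ι → Ω → α} {Y : ι → Ω → β} (hXm : ∀ i, Measurable (X i))
    (hYm : ∀ i, Measurable (Y i)) (hX : iIndepFun X P) (hY : iIndepFun Y P)
    (hXY : IndepFun (fun ω i => X i ω) (fun ω i => Y i ω) P) :
    iIndepFun (fun i ω => (X i ω, Y i ω)) P := by
  have hpX : ∀ i, IsProbabilityMeasure (P.map (X i)) := fun i =>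
    Measure.isProbabilityMeasure_map (hXm i).aemeasurable
  have hpY : ∀ i, IsProbabilityMeasure (P.map (Y i)) := fun i =>
    Measure.isProbabilityMeasure_map (hYm i).aemeasurable
  have hpair : ∀ i, P.map (fun ω => (X i ω, Y i ω)) = (P.map (X i)).prod (P.map (Y i)) := by
    intro i
    have h : IndepFun (X i) (Y i) P :=
      hXY.comp (φ := fun x : ι → α => x i) (ψ := fun y : ι → β => y i) (measurable_pi_apply i)
        (measurable_pi_apply i)
    exact (indepFun_iff_map_prod_eq_prod_map_map (hXm i).aemeasurable (hYm i).aemeasurable).1 h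
  rw [iIndepFun_iff_map_fun_eq_pi_map fun i => ((hXm i).prodMk (hYm i)).aemeasurable]
  simp_rw [hpair]
  have h1 := (measurePreserving_arrowProdEquivProdArrow α β ι (fun i => P.map (X i))
    fun i => P.map (Y i)).symm
  rw [← h1.map_eq, ← hX.map_fun_eq_pi_map fun i => (hXm i).aemeasurable,
    ← hY.map_fun_eq_pi_map fun i => (hYm i).aemeasurable,
    ← (indepFun_iff_map_prod_eq_prod_map_map (measurable_pi_lambda _ hXm).aemeasurable
      (measurable_pi_lambda _ hYm).aemeasurable).1 hXY,
    Measure.map_map h1.measurable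
      ((measurable_pi_lambda _ hXm).prodMk (measurable_pi_lambda _ hYm))]
  rfl

/-- Let `Y` be standard Gaussian and let `e` be an independent sign with mean `μ ∈ [0, 1]`. Writing
`exp (-a e |Y|) = cosh (a Y) - e sinh (a |Y|)`, the first term has mean `exp (a² / 2)` and the
second one mean at least `μ a E|Y| ≥ μ a / 3`; the choice `a = μ / 6` is of the optimal order. -/
lemma lintegral_exp_signed_abs_le [IsProbabilityMeasure P] {e Y : Ω → ℝ} {μ : ℝ}
    (hem : Measurable e) (hYm : Measurable Y) (he : ∀ ω, |e ω| = 1)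
    (hY : P.map Y = gaussianReal 0 1) (hind : IndepFun e Y P) (hμ : ∫ ω, e ω ∂P = μ)
    (hμ0 : 0 ≤ μ) (hμ1 : μ ≤ 1) :
    ∫⁻ ω, ENNReal.ofReal (Real.exp (-(μ / 6) * (e ω * |Y ω|))) ∂P ≤
      ENNReal.ofReal (Real.exp (-(μ ^ 2 / 36))) := by
  set a := μ / 6 with ha
  have ha0 : 0 ≤ a := by positivity
  have hexp : ∀ t : ℝ, Integrable (fun ω => Real.exp (t * Y ω)) P := by
    intro t
    have h := integrable_exp_mul_gaussianReal (μ := 0) (v := 1) t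
    rw [← hY] at h
    exact h.comp_measurable hYm
  have hmgf : ∀ t : ℝ, ∫ ω, Real.exp (t * Y ω) ∂P = Real.exp (t ^ 2 / 2) := by
    intro t
    have := mgf_gaussianReal hY t
    simpa [mgf] using this
  have hcosh : Integrable (fun ω => Real.cosh (a * Y ω)) P := by
    have : (fun ω => Real.cosh (a * Y ω)) =
        fun ω => (Real.exp (a * Y ω) + Real.exp (-a * Y ω)) / 2 := by
      funext ω; rw [Real.cosh_eq, neg_mul]
    rw [this]
    exact ((hexp a).add (hexp (-a))).div_const 2
  have hcoshI : ∫ ω, Real.cosh (a * Y ω) ∂P = Real.exp (a ^ 2 / 2) := by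
    simp_rw [Real.cosh_eq, ← neg_mul]
    rw [integral_div, integral_add (hexp a) (hexp (-a)), hmgf, hmgf]
    ring_nf
  have hsinh : Integrable (fun ω => Real.sinh (a * |Y ω|)) P := by
    refine hcosh.mono' (by fun_prop) (Filter.Eventually.of_forall fun ω => ?_)
    rw [Real.norm_of_nonneg (Real.sinh_nonneg_iff.2 (by positivity)), ← Real.cosh_abs (a * Y ω),
      abs_mul, abs_of_nonneg ha0]
    exact (Real.sinh_lt_cosh _).le
  have hsinhI : a / 3 ≤ ∫ ω, Real.sinh (a * |Y ω|) ∂P := by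
    have habs : ∫ ω, |Y ω| ∂P = ∫ x, |x| ∂(gaussianReal 0 1) := by
      rw [← hY, integral_map hYm.aemeasurable (by fun_prop)]
    have hint : Integrable (fun ω => |Y ω|) P := by
      have h := integrable_abs_gaussianReal
      rw [← hY] at h
      exact h.comp_measurable hYm
    have h1 : ∫ ω, a * |Y ω| ∂P ≤ ∫ ω, Real.sinh (a * |Y ω|) ∂P :=
      integral_mono (hint.const_mul a) hsinh fun ω =>
        Real.self_le_sinh_iff.2 (mul_nonneg ha0 (abs_nonneg _))
    rw [integral_const_mul, habs] at h1
    have := mul_le_mul_of_nonneg_left one_third_le_integral_abs ha0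
    linarith
  have hes : Integrable (fun ω => e ω * Real.sinh (a * |Y ω|)) P := by
    refine hsinh.mono (by fun_prop) (Filter.Eventually.of_forall fun ω => ?_)
    rw [norm_mul, Real.norm_eq_abs (e ω), he, one_mul]
  have hesI : ∫ ω, e ω * Real.sinh (a * |Y ω|) ∂P = μ * ∫ ω, Real.sinh (a * |Y ω|) ∂P := by
    have h := hind.integral_fun_comp_mul_comp (f := fun x => x) (g := fun y => Real.sinh (a * |y|))
      hem.aemeasurable hYm.aemeasurable (by fun_prop) (by fun_prop)
    rw [h, hμ]
  have hpt : ∀ ω, Real.exp (-a * (e ω * |Y ω|)) =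
      Real.cosh (a * Y ω) - e ω * Real.sinh (a * |Y ω|) := by
    intro ω
    rw [← Real.cosh_abs (a * Y ω), abs_mul, abs_of_nonneg ha0]
    rcases (abs_eq zero_le_one).1 (he ω) with h | h <;> rw [h]
    · rw [one_mul, one_mul, Real.cosh_sub_sinh, neg_mul]
    · rw [neg_one_mul, neg_one_mul, sub_neg_eq_add, Real.cosh_add_sinh, neg_mul_neg]
  simp_rw [hpt]
  have hdiff : Integrable (fun ω => Real.cosh (a * Y ω) - e ω * Real.sinh (a * |Y ω|)) P :=
    hcosh.sub hes
  rw [← ofReal_integral_eq_lintegral_ofReal hdiff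
    (Filter.Eventually.of_forall fun ω => by
      change 0 ≤ Real.cosh (a * Y ω) - e ω * Real.sinh (a * |Y ω|)
      rw [← hpt]; positivity)]
  refine ENNReal.ofReal_le_ofReal ?_
  rw [integral_sub hcosh hes, hcoshI, hesI]
  have h1 : μ * (a / 3) ≤ μ * ∫ ω, Real.sinh (a * |Y ω|) ∂P :=
    mul_le_mul_of_nonneg_left hsinhI hμ0
  have hμ2 : μ ^ 2 ≤ 1 := pow_le_one₀ hμ0 hμ1
  have hx0 : 0 ≤ a ^ 2 / 2 := by positivity
  have hx1 : a ^ 2 / 2 ≤ 1 := by rw [ha]; nlinarith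
  have h2 : Real.exp (a ^ 2 / 2) ≤ 1 + 2 * (a ^ 2 / 2) := by
    have := Real.abs_exp_sub_one_le (x := a ^ 2 / 2) (by rwa [abs_of_nonneg hx0])
    rw [abs_of_nonneg hx0] at this
    have := (le_abs_self _).trans this
    linarith
  have h3 := Real.add_one_le_exp (-(μ ^ 2 / 36))
  have h4 : a ^ 2 = μ ^ 2 / 36 := by rw [ha]; ring
  have h5 : μ * (a / 3) = μ ^ 2 / 18 := by rw [ha]; ring
  linarith

end

/-! ### Concentration of the signed sum in one direction -/

lemma measurable_cleanSign {Ω : Type*} {mΩ : MeasurableSpace Ω} {ξ : ℕ → Ω → ℝ} {l s : ℕ}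
    (h : ∀ i < l, Measurable (ξ (s + i))) :
    Measurable fun ω => cleanSign l (fun t => ξ t ω) s := by
  classical
  unfold cleanSign
  refine Measurable.ite ?_ measurable_const measurable_const
  have : {ω | ∀ i < l, ξ (s + i) ω = 0} = ⋂ i ∈ Finset.range l, ξ (s + i) ⁻¹' {0} := by
    ext ω; simp
  rw [this]
  exact Finset.measurableSet_biInter _ fun i hi =>
    h i (Finset.mem_range.1 hi) (measurableSet_singleton 0)

/-- The block `j` of a vector indexed like a stacked input vector. -/
def vecBlock {κ : Type*} {m : ℕ} (v : EuclideanSpace ℝ (κ × Fin m)) (j : κ) :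
    EuclideanSpace ℝ (Fin m) :=
  WithLp.toLp 2 fun c => v (j, c)

lemma sum_sq_norm_vecBlock {κ : Type*} [Fintype κ] {m : ℕ} (v : EuclideanSpace ℝ (κ × Fin m)) :
    ∑ j, ‖vecBlock v j‖ ^ 2 = ‖v‖ ^ 2 := by
  simp only [EuclideanSpace.real_norm_sq_eq, Fintype.sum_prod_type, vecBlock]

lemma inner_inputWindow {m l : ℕ} (v : EuclideanSpace ℝ (Fin (l + 1) × Fin m))
    (u : ℕ → EuclideanSpace ℝ (Fin m)) (t : ℕ) :
    inner ℝ v (inputWindow (l + 1) u t) =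
      ∑ j : Fin (l + 1), inner ℝ (vecBlock v j) (u (t - j)) := by
  simp only [PiLp.inner_apply, Fintype.sum_prod_type, vecBlock, inputWindow]

section

variable {Ω : Type*} [MeasurableSpace Ω] {P : Measure Ω} [IsProbabilityMeasure P]
  {n m l T : ℕ} {x₀ : Ω → EuclideanSpace ℝ (Fin n)} {w : ℕ → Ω → EuclideanSpace ℝ (Fin n)}
  {u : ℕ → Ω → EuclideanSpace ℝ (Fin m)} {ξ : ℕ → Ω → ℝ} {σ : ℝ} {p : unitInterval}

lemma map_inner_inputWindow (hσ : 0 < σ) (hu : IsGaussianInput P u σ (T + l))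
    (v : EuclideanSpace ℝ (Fin (l + 1) × Fin m)) (hv : σ * ‖v‖ = 1) {s : ℕ} (hs : s < T) :
    P.map (fun ω => inner ℝ v (inputWindow (l + 1) (fun t => u t ω) (s + l))) =
      gaussianReal 0 1 := by
  set X : Fin (l + 1) → Ω → ℝ := fun j ω => inner ℝ (vecBlock v j) (u (s + l - j) ω) with hX
  have hlt : ∀ j : Fin (l + 1), s + l - j < T + l := fun j => by omega
  have hXm : ∀ j, Measurable (X j) := fun j =>
    (by fun_prop : Measurable fun x : EuclideanSpace ℝ (Fin m) => inner ℝ (vecBlock v j) x).comp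
      (hu.measurable _ (hlt j))
  have hXi : iIndepFun X P := by
    have hinj : Function.Injective fun j : Fin (l + 1) =>
        (⟨s + l - j, hlt j⟩ : Fin (T + l)) := by
      intro j j' h
      have h' := congrArg Fin.val h
      have := j.2
      have := j'.2
      ext
      simp only at h'
      omega
    exact (hu.iIndep.precomp hinj).comp (fun j x => inner ℝ (vecBlock v j) x)
      fun j => by fun_prop
  have hlaw : ∀ j, P.map (X j) = (gaussianReal 0 1).map (fun z => ‖σ • vecBlock v j‖ * z) := by
    intro j
    rw [← map_inner_stdGaussian]
    have h1 := (hu.law _ (hlt j)).map_eq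
    rw [multivariateGaussian_smul_one] at h1
    calc P.map (X j) = (P.map (u (s + l - j))).map (fun x => inner ℝ (vecBlock v j) x) := by
          rw [Measure.map_map (by fun_prop) (hu.measurable _ (hlt j))]
          rfl
      _ = _ := by
          rw [h1, Measure.map_map (by fun_prop) (by fun_prop)]
          congr 1
          funext g
          simp [real_inner_smul_left, real_inner_smul_right]
  simp_rw [inner_inputWindow]
  change P.map (fun ω => ∑ j, X j ω) = _
  have : IsProbabilityMeasure (P.map (fun ω => ∑ j, X j ω)) :=
    Measure.isProbabilityMeasure_map (by fun_prop)
  refine Measure.ext_of_charFun ?_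
  rw [hXi.charFun_map_fun_sum_eq_prod fun j => (hXm j).aemeasurable]
  funext t
  rw [Finset.prod_apply]
  simp_rw [hlaw, charFun_map_mul, charFun_gaussianReal]
  rw [← Complex.exp_sum]
  congr 1
  have h2 : ∑ j, (‖σ • vecBlock v j‖ * t) ^ 2 = t ^ 2 := by
    simp_rw [mul_pow, norm_smul, mul_pow, Real.norm_of_nonneg hσ.le]
    rw [← Finset.sum_mul, ← Finset.mul_sum, sum_sq_norm_vecBlock, ← mul_pow, hv]
    ring
  have h3 : ((∑ j, (‖σ • vecBlock v j‖ * t) ^ 2 : ℝ) : ℂ) = ((t ^ 2 : ℝ) : ℂ) := by rw [h2]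
  push_cast at h3 ⊢
  simp only [mul_zero, zero_mul, one_mul, zero_sub]
  rw [Finset.sum_neg_distrib, ← Finset.sum_div, h3]

lemma integral_cleanSign (hξ : IsProbabilisticAttack P x₀ w ξ p) (l s : ℕ) :
    ∫ ω, cleanSign l (fun t => ξ t ω) s ∂P = 2 * (1 - (p : ℝ)) ^ l - 1 := by
  classical
  set A : Set Ω := ⋂ i ∈ Finset.range l, ξ (s + i) ⁻¹' {0} with hA
  have hAm : MeasurableSet A := Finset.measurableSet_biInter _ fun i _ =>
    hξ.measurable _ (measurableSet_singleton 0)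
  have hone : ∀ t, P.real (ξ t ⁻¹' {0}) = 1 - (p : ℝ) := by
    intro t
    have h1 := bernoulliMeasure_real_apply_of_notMem_of_mem (x := (1 : ℝ)) (y := 0) p
      (measurableSet_singleton (0 : ℝ)) (by simp) (by simp)
    rw [← (hξ.law t).map_eq, map_measureReal_apply (hξ.measurable t) (measurableSet_singleton _)]
      at h1
    exact h1
  have hPA : P.real A = (1 - (p : ℝ)) ^ l := by
    have hind : iIndepFun (fun i => ξ (s + i)) P :=
      hξ.iIndep.precomp (g := fun i => s + i) (add_right_injective s)
    have h1 := hind.measure_inter_preimage_eq_mul (Finset.range l) (sets := fun _ => {0})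
      fun _ _ => measurableSet_singleton 0
    rw [measureReal_def, hA, h1, ENNReal.toReal_prod]
    simp_rw [← measureReal_def, hone]
    simp
  have hfun : (fun ω => cleanSign l (fun t => ξ t ω) s) =
      fun ω => 2 * A.indicator (fun _ => (1 : ℝ)) ω - 1 := by
    funext ω
    have hmem : ω ∈ A ↔ ∀ i < l, ξ (s + i) ω = 0 := by simp [hA]
    unfold cleanSign
    by_cases h : ∀ i < l, ξ (s + i) ω = 0
    · rw [if_pos h, Set.indicator_of_mem (hmem.2 h)]; norm_num
    · rw [if_neg h, Set.indicator_of_notMem (mt hmem.1 h)]; norm_num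
  rw [hfun, integral_sub (((integrable_const _).indicator hAm).const_mul 2) (integrable_const _),
    integral_const_mul, integral_indicator_const _ hAm, hPA]
  simp

/-- The exponential moment of one signed term; the sign depends only on the attack times, which are
independent of the inputs. -/
lemma lintegral_exp_cleanSign_le (hξ : IsProbabilisticAttack P x₀ w ξ p) (hσ : 0 < σ)
    (hu : IsGaussianInput P u σ (T + l))
    (hind : IndepFun (fun ω (t : ℕ) => ξ t ω) (fun ω (t : Fin (T + l)) => u t ω) P)
    {μ : ℝ} (hμ : μ = 2 * (1 - (p : ℝ)) ^ l - 1) (hμ0 : 0 ≤ μ) (hμ1 : μ ≤ 1)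
    (v : EuclideanSpace ℝ (Fin (l + 1) × Fin m)) (hv : σ * ‖v‖ = 1) {s : ℕ} (hs : s < T) :
    ∫⁻ ω, ENNReal.ofReal (Real.exp (-(μ / 6) * (cleanSign l (fun t => ξ t ω) s *
        |inner ℝ v (inputWindow (l + 1) (fun t => u t ω) (s + l))|))) ∂P ≤
      ENNReal.ofReal (Real.exp (-(μ ^ 2 / 36))) := by
  have hlt : ∀ j : Fin (l + 1), s + l - j < T + l := fun j => by omega
  have hφ : Measurable fun x : ℕ → ℝ => cleanSign l x s :=
    measurable_cleanSign (ξ := fun t (x : ℕ → ℝ) => x t) fun i _ => measurable_pi_apply _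
  have hψ : Measurable fun y : Fin (T + l) → EuclideanSpace ℝ (Fin m) =>
      ∑ j : Fin (l + 1), inner ℝ (vecBlock v j) (y ⟨s + l - j, hlt j⟩) := by
    fun_prop
  have hI := hind.comp hφ hψ
  have hZ : (fun y : Fin (T + l) → EuclideanSpace ℝ (Fin m) =>
      ∑ j : Fin (l + 1), inner ℝ (vecBlock v j) (y ⟨s + l - j, hlt j⟩)) ∘
        (fun ω (t : Fin (T + l)) => u t ω) =
      fun ω => inner ℝ v (inputWindow (l + 1) (fun t => u t ω) (s + l)) := by
    funext ω
    rw [inner_inputWindow]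
    rfl
  have hum : Measurable fun ω (t : Fin (T + l)) => u t ω :=
    measurable_pi_lambda _ fun t => hu.measurable t t.2
  have hZm := hψ.comp hum
  rw [hZ] at hI hZm
  exact lintegral_exp_signed_abs_le (measurable_cleanSign fun i _ => hξ.measurable _) hZm
    (fun ω => abs_cleanSign _ _ _) (map_inner_inputWindow hσ hu v hv hs) hI
    ((integral_cleanSign hξ l s).trans hμ.symm) hμ0 hμ1

/-- The sum over one residue class modulo `l + 1` has independent terms, because the windows of
different times in the class are disjoint. -/
lemma lintegral_prod_residue_class_le (hξ : IsProbabilisticAttack P x₀ w ξ p) (hσ : 0 < σ)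
    (hu : IsGaussianInput P u σ (T + l))
    (hind : IndepFun (fun ω (t : ℕ) => ξ t ω) (fun ω (t : Fin (T + l)) => u t ω) P)
    {μ : ℝ} (hμ : μ = 2 * (1 - (p : ℝ)) ^ l - 1) (hμ0 : 0 ≤ μ) (hμ1 : μ ≤ 1)
    (v : EuclideanSpace ℝ (Fin (l + 1) × Fin m)) (hv : σ * ‖v‖ = 1) (j : ℕ) :
    ∫⁻ ω, ∏ s ∈ (Finset.range T).filter (fun s => s % (l + 1) = j),
        ENNReal.ofReal (Real.exp (-(μ / 6) * (cleanSign l (fun t => ξ t ω) s *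
        |inner ℝ v (inputWindow (l + 1) (fun t => u t ω) (s + l))|))) ∂P ≤
      ENNReal.ofReal (Real.exp (-(μ ^ 2 / 36))) ^
        ((Finset.range T).filter (fun s => s % (l + 1) = j)).card := by
  set V : Fin (T + l) → Ω → ℝ × EuclideanSpace ℝ (Fin m) := fun i ω => (ξ i ω, u i ω) with hV
  have hVi : iIndepFun V P := by
    refine iIndepFun_prodMk (fun i => hξ.measurable i) (fun i => hu.measurable i i.2)
      (hξ.iIndep.precomp Fin.val_injective) hu.iIndep ?_
    exact hind.comp (φ := fun (x : ℕ → ℝ) (i : Fin (T + l)) => x i) (ψ := id) (by fun_prop)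
      measurable_id
  set M : Fin (T + l) → MeasurableSpace Ω := fun i => MeasurableSpace.comap (V i) inferInstance
    with hM
  set I : ℕ → Set (Fin (T + l)) := fun s => {i | s ≤ i.1 ∧ i.1 ≤ s + l} with hI
  have hξM : ∀ s, ∀ t (ht : t < T + l), s ≤ t → t ≤ s + l →
      Measurable[⨆ i ∈ I s, M i] (ξ t) ∧ Measurable[⨆ i ∈ I s, M i] (u t) := by
    intro s t ht h1 h2
    have hVt : Measurable[⨆ i ∈ I s, M i] (V ⟨t, ht⟩) :=
      Measurable.of_comap_le (le_iSup₂ (f := fun i (_ : i ∈ I s) => M i) ⟨t, ht⟩ ⟨h1, h2⟩)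
    exact ⟨measurable_fst.comp hVt, measurable_snd.comp hVt⟩
  rw [lintegral_prod_of_disjoint_blocks (M := M) (fun i =>
    ((hξ.measurable i).prodMk (hu.measurable i i.2)).comap_le) hVi.iIndep I]
  · rw [← Finset.prod_const]
    refine Finset.prod_le_prod' fun s hs => ?_
    exact lintegral_exp_cleanSign_le hξ hσ hu hind hμ hμ0 hμ1 v hv
      (Finset.mem_range.1 (Finset.mem_filter.1 hs).1)
  · intro s hs s' hs' hne
    have h1 := (Finset.mem_filter.1 hs).2
    have h2 := (Finset.mem_filter.1 hs').2
    rw [Set.disjoint_left]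
    rintro i ⟨h3, h4⟩ ⟨h5, h6⟩
    have hmod : s ≡ s' [MOD l + 1] := h1.trans h2.symm
    rcases lt_or_gt_of_ne hne with h | h
    · have := Nat.le_of_dvd (by omega) ((Nat.modEq_iff_dvd' h.le).1 hmod)
      omega
    · have := Nat.le_of_dvd (by omega) ((Nat.modEq_iff_dvd' h.le).1 hmod.symm)
      omega
  · intro s hs
    have hsT := Finset.mem_range.1 (Finset.mem_filter.1 hs).1
    have hc : Measurable[⨆ i ∈ I s, M i] fun ω => cleanSign l (fun t => ξ t ω) s :=
      measurable_cleanSign fun i hi => (hξM s (s + i) (by omega) (by omega) (by omega)).1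
    have hZ : Measurable[⨆ i ∈ I s, M i] fun ω =>
        inner ℝ v (inputWindow (l + 1) (fun t => u t ω) (s + l)) := by
      simp_rw [inner_inputWindow]
      refine Finset.measurable_fun_sum _ fun j _ => ?_
      have hj := j.2
      exact (by fun_prop : Measurable fun x : EuclideanSpace ℝ (Fin m) =>
        inner ℝ (vecBlock v j) x).comp (hξM s (s + l - j) (by omega) (by omega) (by omega)).2
    exact (by fun_prop : Measurable fun x : ℝ × ℝ =>
      ENNReal.ofReal (Real.exp (-(μ / 6) * (x.1 * |x.2|)))).comp (hc.prodMk hZ)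

lemma le_card_residue_class {k T j : ℕ} (hk : 0 < k) (hkT : k ≤ T) (hj : j < k) :
    (T : ℝ) / (2 * k) ≤ ((Finset.range T).filter (fun s => s % k = j)).card := by
  have h1 : T / k ≤ ((Finset.range T).filter (fun s => s % k = j)).card := by
    have h := Nat.count_modEq_card T hk j
    rw [Nat.count_eq_card_filter_range] at h
    have h2 : (Finset.range T).filter (fun s => s ≡ j [MOD k]) =
        (Finset.range T).filter (fun s => s % k = j) :=
      Finset.filter_congr fun s _ => by rw [Nat.ModEq, Nat.mod_eq_of_lt hj]
    rw [h2] at h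
    omega
  have h3 : T ≤ 2 * k * (T / k) := by
    have := Nat.div_add_mod T k
    have := Nat.mod_lt T hk
    have : 1 ≤ T / k := (Nat.one_le_div_iff hk).2 hkT
    nlinarith
  have hk' : (0 : ℝ) < k := by exact_mod_cast hk
  rw [div_le_iff₀ (by positivity)]
  calc (T : ℝ) ≤ 2 * k * (T / k : ℕ) := by exact_mod_cast h3
    _ ≤ 2 * k * ((Finset.range T).filter (fun s => s % k = j)).card := by
      gcongr
    _ = _ := mul_comm _ _

/-- Concentration in a normalized direction. Convexity of the exponential reduces the exponential
moment of the whole sum to those of the residue classes modulo `l + 1`. -/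
lemma measure_signedSum_lt_le_of_norm (hξ : IsProbabilisticAttack P x₀ w ξ p) (hσ : 0 < σ)
    (hu : IsGaussianInput P u σ (T + l))
    (hind : IndepFun (fun ω (t : ℕ) => ξ t ω) (fun ω (t : Fin (T + l)) => u t ω) P)
    {μ : ℝ} (hμ : μ = 2 * (1 - (p : ℝ)) ^ l - 1) (hμ0 : 0 ≤ μ) (hμ1 : μ ≤ 1) (hT : l + 1 ≤ T)
    (v : EuclideanSpace ℝ (Fin (l + 1) × Fin m)) (hv : σ * ‖v‖ = 1) :
    P {ω | signedSum T (cleanSign l fun t => ξ t ω)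
        (fun s => inputWindow (l + 1) (fun t => u t ω) (s + l)) v < μ * T / 24} ≤
      ENNReal.ofReal (Real.exp (-(μ ^ 2 * T / (144 * (l + 1 : ℕ))))) := by
  have hk0 : 0 < l + 1 := Nat.succ_pos l
  obtain ⟨k, hk⟩ : ∃ k : ℝ, k = ((l + 1 : ℕ) : ℝ) := ⟨_, rfl⟩
  have hkr : 0 < k := by rw [hk]; exact_mod_cast hk0
  rw [← hk]
  set Y : ℕ → Ω → ℝ := fun s ω => cleanSign l (fun t => ξ t ω) s *
    |inner ℝ v (inputWindow (l + 1) (fun t => u t ω) (s + l))| with hY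
  set C : ℕ → Finset ℕ := fun j => (Finset.range T).filter (fun s => s % (l + 1) = j) with hC
  set f : ℕ → Ω → ENNReal := fun j ω =>
    ∏ s ∈ C j, ENNReal.ofReal (Real.exp (-(μ / 6) * Y s ω)) with hf
  have hYm : ∀ s ∈ Finset.range T, Measurable (Y s) := by
    intro s hs
    have hs := Finset.mem_range.1 hs
    have hc : Measurable fun ω => cleanSign l (fun t => ξ t ω) s :=
      measurable_cleanSign fun i _ => hξ.measurable _
    have hZ : Measurable fun ω => inner ℝ v (inputWindow (l + 1) (fun t => u t ω) (s + l)) := by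
      simp_rw [inner_inputWindow]
      refine Finset.measurable_fun_sum _ fun j _ => ?_
      exact (by fun_prop : Measurable fun x : EuclideanSpace ℝ (Fin m) =>
        inner ℝ (vecBlock v j) x).comp (hu.measurable _ (by omega))
    fun_prop
  have hfm : ∀ j, Measurable (f j) := fun j => Finset.measurable_fun_prod _ fun s hs => by
    have := hYm s (Finset.mem_filter.1 hs).1
    fun_prop
  have hE : ∀ j ∈ Finset.range (l + 1), ∫⁻ ω, f j ω ∂P ≤
      ENNReal.ofReal (Real.exp (-(μ ^ 2 * T / (72 * k)))) := by
    intro j hj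
    refine (lintegral_prod_residue_class_le hξ hσ hu hind hμ hμ0 hμ1 v hv j).trans ?_
    rw [← ENNReal.ofReal_pow (Real.exp_pos _).le, ← Real.exp_nat_mul]
    refine ENNReal.ofReal_le_ofReal (Real.exp_le_exp.2 ?_)
    have h1 := le_card_residue_class hk0 hT (Finset.mem_range.1 hj)
    rw [← hk] at h1
    have h2 := mul_le_mul_of_nonneg_right h1 (by positivity : 0 ≤ μ ^ 2 / 36)
    have h3 : (T : ℝ) / (2 * k) * (μ ^ 2 / 36) = μ ^ 2 * T / (72 * k) := by
      field_simp; ring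
    linarith
  have hS : ∀ ω, signedSum T (cleanSign l fun t => ξ t ω)
      (fun s => inputWindow (l + 1) (fun t => u t ω) (s + l)) v =
      ∑ j ∈ Finset.range (l + 1), ∑ s ∈ C j, Y s ω := by
    intro ω
    rw [signedSum]
    exact (Finset.sum_fiberwise_of_maps_to (fun s _ => Finset.mem_range.2 (Nat.mod_lt s hk0)) _).symm
  have hpt : ∀ ω, ENNReal.ofReal (Real.exp (-(μ / (6 * k)) *
      ∑ j ∈ Finset.range (l + 1), ∑ s ∈ C j, Y s ω)) ≤
      ∑ j ∈ Finset.range (l + 1), ENNReal.ofReal k⁻¹ * f j ω := by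
    intro ω
    have h := convexOn_exp.map_sum_le (t := Finset.range (l + 1)) (w := fun _ => k⁻¹)
      (p := fun j => -(μ / 6) * ∑ s ∈ C j, Y s ω) (fun _ _ => by positivity)
      (by simp [hk]; field_simp) (fun _ _ => Set.mem_univ _)
    have h2 : ∑ j ∈ Finset.range (l + 1), k⁻¹ • (-(μ / 6) * ∑ s ∈ C j, Y s ω) =
        -(μ / (6 * k)) * ∑ j ∈ Finset.range (l + 1), ∑ s ∈ C j, Y s ω := by
      rw [Finset.mul_sum]
      refine Finset.sum_congr rfl fun j _ => ?_
      rw [smul_eq_mul]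
      field_simp
    rw [h2] at h
    refine (ENNReal.ofReal_le_ofReal h).trans (le_of_eq ?_)
    rw [ENNReal.ofReal_sum_of_nonneg fun _ _ => by positivity]
    refine Finset.sum_congr rfl fun j _ => ?_
    rw [smul_eq_mul, ENNReal.ofReal_mul (by positivity), Finset.mul_sum, Real.exp_sum,
      ENNReal.ofReal_prod_of_nonneg fun _ _ => (Real.exp_pos _).le]
  set θ := ENNReal.ofReal (Real.exp (-(μ ^ 2 * T / (144 * k)))) with hθ
  have hθ0 : θ ≠ 0 := by simp [hθ, Real.exp_pos]
  have hsub : {ω | signedSum T (cleanSign l fun t => ξ t ω)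
      (fun s => inputWindow (l + 1) (fun t => u t ω) (s + l)) v < μ * T / 24} ⊆
      {ω | θ ≤ ∑ j ∈ Finset.range (l + 1), ENNReal.ofReal k⁻¹ * f j ω} := by
    intro ω hω
    rw [Set.mem_ofPred_eq, hS] at hω
    refine le_trans (ENNReal.ofReal_le_ofReal (Real.exp_le_exp.2 ?_)) (hpt ω)
    have h1 := mul_le_mul_of_nonneg_left hω.le (by positivity : 0 ≤ μ / (6 * k))
    have h2 : μ / (6 * k) * (μ * T / 24) = μ ^ 2 * T / (144 * k) := by
      field_simp; ring
    linarith
  have hint : ∫⁻ ω, ∑ j ∈ Finset.range (l + 1), ENNReal.ofReal k⁻¹ * f j ω ∂P ≤ θ * θ := by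
    rw [lintegral_finsetSum _ fun j _ => (hfm j).const_mul _]
    have h1 : ∀ j ∈ Finset.range (l + 1), ∫⁻ ω, ENNReal.ofReal k⁻¹ * f j ω ∂P ≤
        ENNReal.ofReal k⁻¹ * ENNReal.ofReal (Real.exp (-(μ ^ 2 * T / (72 * k)))) := by
      intro j hj
      rw [lintegral_const_mul _ (hfm j)]
      exact mul_le_mul_right (hE j hj) _
    refine (Finset.sum_le_sum h1).trans (le_of_eq ?_)
    rw [Finset.sum_const, Finset.card_range, nsmul_eq_mul, ← mul_assoc,
      ← ENNReal.ofReal_natCast, ← hk, ← ENNReal.ofReal_mul hkr.le, mul_inv_cancel₀ hkr.ne',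
      ENNReal.ofReal_one, one_mul, hθ, ← ENNReal.ofReal_mul (Real.exp_pos _).le, ← Real.exp_add]
    congr 2
    field_simp
    ring
  have hmarkov := mul_meas_ge_le_lintegral₀ (μ := P)
    (Finset.aemeasurable_fun_sum (Finset.range (l + 1)) fun j _ =>
      ((hfm j).const_mul (ENNReal.ofReal k⁻¹)).aemeasurable) θ
  have h1 := ((mul_le_mul_right (measure_mono hsub) θ).trans hmarkov).trans hint
  exact (ENNReal.mul_le_mul_iff_right hθ0 ENNReal.ofReal_ne_top).1 h1

lemma measure_signedSum_lt_le (hξ : IsProbabilisticAttack P x₀ w ξ p) (hσ : 0 < σ)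
    (hu : IsGaussianInput P u σ (T + l))
    (hind : IndepFun (fun ω (t : ℕ) => ξ t ω) (fun ω (t : Fin (T + l)) => u t ω) P)
    {μ : ℝ} (hμ : μ = 2 * (1 - (p : ℝ)) ^ l - 1) (hμ0 : 0 ≤ μ) (hμ1 : μ ≤ 1) (hT : l + 1 ≤ T)
    (v : EuclideanSpace ℝ (Fin (l + 1) × Fin m)) :
    P {ω | signedSum T (cleanSign l fun t => ξ t ω)
        (fun s => inputWindow (l + 1) (fun t => u t ω) (s + l)) v < μ * T * σ / 24 * ‖v‖} ≤
      ENNReal.ofReal (Real.exp (-(μ ^ 2 * T / (144 * (l + 1 : ℕ))))) := by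
  rcases eq_or_ne v 0 with rfl | hv
  · simp [signedSum]
  have hv0 : 0 < ‖v‖ := norm_pos_iff.2 hv
  have hn : σ * ‖(σ * ‖v‖)⁻¹ • v‖ = 1 := by
    rw [norm_smul, Real.norm_of_nonneg (by positivity)]
    field_simp
  refine le_trans (measure_mono fun ω hω => ?_)
    (measure_signedSum_lt_le_of_norm hξ hσ hu hind hμ hμ0 hμ1 hT _ hn)
  rw [Set.mem_ofPred_eq] at hω ⊢
  rw [signedSum_smul, abs_of_pos (by positivity), inv_mul_lt_iff₀ (by positivity)]
  linarith

end

/-! ### Estimation error on the good event and its probability -/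

lemma norm_inputWindow_le {m : ℕ} (l : ℕ) (u : ℕ → EuclideanSpace ℝ (Fin m)) (t : ℕ) :
    ‖inputWindow (l + 1) u t‖ ≤ ∑ j : Fin (l + 1), ‖u (t - j)‖ := by
  have h0 : 0 ≤ ∑ j : Fin (l + 1), ‖u (t - j)‖ := Finset.sum_nonneg fun _ _ => norm_nonneg _
  refine (pow_le_pow_iff_left₀ (norm_nonneg _) h0 two_ne_zero).1 ?_
  rw [← sum_sq_norm_vecBlock]
  exact Finset.sum_sq_le_sq_sum_of_nonneg fun _ _ => norm_nonneg _

lemma sum_norm_inputWindow_le {m : ℕ} (l T : ℕ) (u : ℕ → EuclideanSpace ℝ (Fin m)) :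
    ∑ s ∈ Finset.range T, ‖inputWindow (l + 1) u (s + l)‖ ≤
      (l + 1 : ℕ) * ∑ i ∈ Finset.range (T + l), ‖u i‖ := by
  calc ∑ s ∈ Finset.range T, ‖inputWindow (l + 1) u (s + l)‖
      ≤ ∑ s ∈ Finset.range T, ∑ j : Fin (l + 1), ‖u (s + l - j)‖ :=
        Finset.sum_le_sum fun s _ => norm_inputWindow_le l u (s + l)
    _ = ∑ j : Fin (l + 1), ∑ s ∈ Finset.range T, ‖u (s + l - j)‖ := Finset.sum_comm
    _ ≤ ∑ _j : Fin (l + 1), ∑ i ∈ Finset.range (T + l), ‖u i‖ := by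
        refine Finset.sum_le_sum fun j _ => ?_
        have hj := j.2
        have h1 : ∑ s ∈ Finset.range T, ‖u (s + l - j)‖ =
            ∑ s ∈ Finset.range T, ‖u (l - j + s)‖ :=
          Finset.sum_congr rfl fun s _ => by
            rw [show s + l - (j : ℕ) = l - j + s by omega]
        have h2 := Finset.sum_range_add (fun i => ‖u i‖) (l - j) T
        have h3 : ∑ i ∈ Finset.range (l - j + T), ‖u i‖ ≤ ∑ i ∈ Finset.range (T + l), ‖u i‖ :=
          Finset.sum_le_sum_of_subset_of_nonneg
            (Finset.range_subset_range.2 (by omega)) fun _ _ _ => norm_nonneg _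
        have h4 : 0 ≤ ∑ i ∈ Finset.range (l - j), ‖u i‖ :=
          Finset.sum_nonneg fun _ _ => norm_nonneg _
        linarith
    _ = _ := by simp

/-- The estimation error on the event where the signed sums are bounded below and the inputs and
attacks have moderate total size. -/
lemma frobNorm_sub_le {n m r l T : ℕ} {ψ ρ η σ μ : ℝ} {A : Matrix (Fin n) (Fin n) ℝ}
    (hA : IsStable A ψ ρ) (B : Matrix (Fin n) (Fin m) ℝ) (C : Matrix (Fin r) (Fin n) ℝ)
    (D : Matrix (Fin r) (Fin m) ℝ) (x₀ : EuclideanSpace ℝ (Fin n))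
    (u : ℕ → EuclideanSpace ℝ (Fin m)) (w : ℕ → EuclideanSpace ℝ (Fin n)) (ξ : ℕ → ℝ)
    (hξ : ∀ t, ξ t = 0 → w t = 0) (hη : 0 < η) (hσ : 0 < σ) (hμ : 0 < μ) (hT : l + 1 ≤ T)
    (hS : ∀ v, μ * T * σ / 48 * ‖v‖ ≤ signedSum T (cleanSign l ξ)
      (fun s => inputWindow (l + 1) u (s + l)) v)
    (hu : ∑ s ∈ Finset.range (T + l), ‖u s‖ ≤ 22 * (σ * √m) * (T + l : ℕ))
    (hw : ‖x₀‖ + ∑ s ∈ Finset.range T, ‖w s‖ ≤ 22 * η * (T + 1 : ℕ))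
    (G : Matrix (Fin r) (Fin (l + 1) × Fin m) ℝ)
    (hG : IsL2Estimate (l + 1) T u (observation A B C D x₀ u w) G) :
    frobNorm (markovMatrix A B C D (l + 1) - G) ≤
      4224 * ψ * (ρ ^ l * (specNorm C / μ * (η / σ + √m * specNorm B)) / (1 - ρ)) := by
  have hψ := hA.psi_pos
  have hρ0 := hA.rho_nonneg
  have hρ1 : 0 < 1 - ρ := sub_pos.2 hA.rho_lt_one
  have hT0 : (0 : ℝ) < T := by exact_mod_cast (by omega : 0 < T)
  have hTl : ((T + l : ℕ) : ℝ) ≤ 2 * T := by exact_mod_cast (by omega : T + l ≤ 2 * T)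
  have hT1 : ((T + 1 : ℕ) : ℝ) ≤ 2 * T := by exact_mod_cast (by omega : T + 1 ≤ 2 * T)
  have hB := specNorm_nonneg B
  have hC := specNorm_nonneg C
  set Z := ∑ s ∈ Finset.range T,
    stateBound ρ ‖x₀‖ (fun t => specNorm B * ‖u t‖ + ‖w t‖) s with hZ
  set F := frobNorm (markovMatrix A B C D (l + 1) - G)
  have hb : ∀ t, 0 ≤ specNorm B * ‖u t‖ + ‖w t‖ := fun t => by positivity
  have h1 : μ * T * σ / 48 * F ≤ 2 * specNorm C * ψ * ρ ^ l * Z :=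
    (mul_frobNorm_le_sum (by positivity) T (cleanSign l ξ) _ hS _).trans
      (sum_cleanSign_mul_norm_le hA B C D x₀ u w ξ hξ l T G hG)
  have h2 : (1 - ρ) * Z ≤ 44 * T * (η + σ * √m * specNorm B) := by
    have h3 := sum_stateBound ρ ‖x₀‖ (fun t => specNorm B * ‖u t‖ + ‖w t‖) T
    have h4 := stateBound_nonneg (a := ‖x₀‖) hρ0 (norm_nonneg _) hb T
    rw [Finset.sum_add_distrib, ← Finset.mul_sum] at h3
    have h5 : ∑ s ∈ Finset.range T, ‖u s‖ ≤ ∑ s ∈ Finset.range (T + l), ‖u s‖ :=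
      Finset.sum_le_sum_of_subset_of_nonneg
        (Finset.range_subset_range.2 (by omega)) fun _ _ _ => norm_nonneg _
    have h6 : specNorm B * ∑ s ∈ Finset.range T, ‖u s‖ ≤
        specNorm B * (22 * (σ * √m) * (2 * T)) :=
      mul_le_mul_of_nonneg_left ((h5.trans hu).trans (by gcongr)) hB
    have h7 : 22 * η * ((T + 1 : ℕ) : ℝ) ≤ 22 * η * (2 * T) := by gcongr
    linarith
  have h3 : 2 * specNorm C * ψ * ρ ^ l * Z ≤ 2 * specNorm C * ψ * ρ ^ l *
      (44 * T * (η + σ * √m * specNorm B) / (1 - ρ)) := by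
    gcongr
    rw [le_div_iff₀ hρ1]
    linarith
  have h4 : μ * T * σ / 48 * (4224 * ψ * (ρ ^ l *
      (specNorm C / μ * (η / σ + √m * specNorm B)) / (1 - ρ))) =
      2 * specNorm C * ψ * ρ ^ l * (44 * T * (η + σ * √m * specNorm B) / (1 - ρ)) := by
    field_simp
    ring
  refine le_of_mul_le_mul_left ?_ (by positivity : 0 < μ * T * σ / 48)
  rw [h4]
  exact h1.trans h3

/-- The failure probabilities add up to at most `exp (-τ / 576)` without a constant in front; the
factor `10` in the exponent of the attack and input terms is what makes this possible for `τ = 1`. -/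
lemma exp_add_two_mul_exp_le {τ : ℝ} (hτ : 1 ≤ τ) :
    Real.exp (-(τ / 288)) + 2 * Real.exp (-(10 * τ)) ≤ Real.exp (-(τ / 576)) := by
  set x := Real.exp (-(τ / 576)) with hx
  have hx0 : 0 < x := Real.exp_pos _
  have h1 : Real.exp (-(τ / 288)) = x * x := by
    rw [hx, ← Real.exp_add]; congr 1; ring
  have h2 : x ≤ 576 / 577 := by
    have h3 := Real.add_one_le_exp (τ / 576)
    have h4 : x * Real.exp (τ / 576) = 1 := by rw [hx, ← Real.exp_add]; simp
    nlinarith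
  have h3 : Real.exp (-(10 * τ)) ≤ x * (1 / 1154) := by
    have h4 : Real.exp (-(10 * τ)) ≤ x * Real.exp (-9) := by
      rw [hx, ← Real.exp_add]
      exact Real.exp_le_exp.2 (by linarith)
    have h5 : Real.exp (-9) ≤ 1 / 1154 := by
      rw [Real.exp_neg, one_div]
      refine inv_anti₀ (by norm_num) ?_
      have h6 : (2.7 : ℝ) ≤ Real.exp 1 := by linarith [Real.exp_one_gt_d9]
      have h7 : Real.exp 9 = Real.exp 1 ^ 9 := by rw [← Real.exp_nat_mul]; norm_num
      rw [h7]
      calc (1154 : ℝ) ≤ 2.7 ^ 9 := by norm_num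
        _ ≤ _ := by gcongr
    exact h4.trans (mul_le_mul_of_nonneg_left h5 hx0.le)
  rw [h1]
  nlinarith

section

variable {Ω : Type*} [MeasurableSpace Ω] {P : Measure Ω} [IsProbabilityMeasure P]

/-- The probability bound, given a finite set of integer directions that controls all directions. -/
lemma measure_frobNorm_gt_le {n m r l T : ℕ} {ψ ρ η σ μ δ : ℝ} {p : unitInterval}
    {A : Matrix (Fin n) (Fin n) ℝ} (hA : IsStable A ψ ρ) (B : Matrix (Fin n) (Fin m) ℝ)
    (C : Matrix (Fin r) (Fin n) ℝ) (D : Matrix (Fin r) (Fin m) ℝ)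
    {x₀ : Ω → EuclideanSpace ℝ (Fin n)} {w : ℕ → Ω → EuclideanSpace ℝ (Fin n)}
    {u : ℕ → Ω → EuclideanSpace ℝ (Fin m)} {ξ : ℕ → Ω → ℝ} (hx₀ : Measurable x₀)
    (hw : ∀ t, Measurable (w t)) (hη : IsSubGaussianAttack P x₀ w η)
    (hξ : IsProbabilisticAttack P x₀ w ξ p) (hσ : 0 < σ) (hu : IsGaussianInput P u σ (T + l))
    (hind : IndepFun (fun ω (t : ℕ) => ξ t ω) (fun ω (t : Fin (T + l)) => u t ω) P)
    (hμ : μ = 2 * (1 - (p : ℝ)) ^ l - 1) (hμ0 : 0 < μ) (hμ1 : μ ≤ 1) (hm : 0 < m)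
    (hT : l + 1 ≤ T) (hδ : 0 < δ)
    (hτ : 1 ≤ μ ^ 2 * T / (l + 1 : ℕ)) (hδτ : 576 * Real.log (1 / δ) ≤ μ ^ 2 * T / (l + 1 : ℕ))
    (V : Finset (Fin (l + 1) × Fin m → ℤ))
    (hVcard : (V.card : ℝ) ≤ Real.exp (μ ^ 2 * T / (l + 1 : ℕ) / 288))
    (hV : ∀ (e : ℕ → ℝ) (U : ℕ → EuclideanSpace ℝ (Fin (l + 1) × Fin m)), (∀ s, |e s| ≤ 1) →
      ∑ s ∈ Finset.range T, ‖U s‖ ≤ 44 * (l + 1 : ℕ) * (σ * √m) * T →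
      (∀ z ∈ V, μ * T * σ / 24 * ‖intVec z‖ ≤ signedSum T e U (intVec z)) →
      ∀ v, μ * T * σ / 48 * ‖v‖ ≤ signedSum T e U v) :
    P {ω | ¬ ∀ G : Matrix (Fin r) (Fin (l + 1) × Fin m) ℝ,
        IsL2Estimate (l + 1) T (fun t => u t ω)
          (observation A B C D (x₀ ω) (fun t => u t ω) (fun t => w t ω)) G →
        frobNorm (markovMatrix A B C D (l + 1) - G) ≤
          4224 * ψ * (ρ ^ l * (specNorm C / μ * (η / σ + √m * specNorm B)) / (1 - ρ))}
      ≤ ENNReal.ofReal δ := by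
  set τ := μ ^ 2 * T / (l + 1 : ℕ) with hτdef
  set E : (Fin (l + 1) × Fin m → ℤ) → Set Ω := fun z =>
    {ω | signedSum T (cleanSign l fun t => ξ t ω)
      (fun s => inputWindow (l + 1) (fun t => u t ω) (s + l)) (intVec z) <
        μ * T * σ / 24 * ‖intVec z‖} with hE
  set Eu : Set Ω := {ω | 22 * (σ * √m) * (T + l : ℕ) ≤
    ∑ s ∈ Finset.range (T + l), ‖u s ω‖} with hEu
  set Ew : Set Ω := {ω | 22 * η * (T + 1 : ℕ) ≤ ‖x₀ ω‖ + ∑ s ∈ Finset.range T, ‖w s ω‖} with hEw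
  have hTl : ((T + l : ℕ) : ℝ) ≤ 2 * T := by exact_mod_cast (by omega : T + l ≤ 2 * T)
  have hsub : {ω | ¬ ∀ G : Matrix (Fin r) (Fin (l + 1) × Fin m) ℝ,
      IsL2Estimate (l + 1) T (fun t => u t ω)
        (observation A B C D (x₀ ω) (fun t => u t ω) (fun t => w t ω)) G →
      frobNorm (markovMatrix A B C D (l + 1) - G) ≤
        4224 * ψ * (ρ ^ l * (specNorm C / μ * (η / σ + √m * specNorm B)) / (1 - ρ))} ⊆
      ((⋃ z ∈ V, E z) ∪ Eu) ∪ Ew := by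
    intro ω hω
    by_contra hcon
    simp only [Set.mem_union, Set.mem_iUnion, not_or, not_exists] at hcon
    obtain ⟨⟨h1, h2⟩, h3⟩ := hcon
    have h2' : ∑ s ∈ Finset.range (T + l), ‖u s ω‖ ≤ 22 * (σ * √m) * (T + l : ℕ) :=
      (not_le.1 h2).le
    refine hω fun G hG => frobNorm_sub_le hA B C D (x₀ ω) (fun t => u t ω) (fun t => w t ω)
      (fun t => ξ t ω) (fun t ht => hξ.no_attack t ht) hη.eta_pos hσ hμ0 hT
      (hV _ _ (fun s => (abs_cleanSign _ _ _).le) ?_ fun z hz => not_lt.1 (h1 z hz)) h2'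
      (not_le.1 h3).le G hG
    refine (sum_norm_inputWindow_le l T fun t => u t ω).trans ?_
    calc ((l + 1 : ℕ) : ℝ) * ∑ i ∈ Finset.range (T + l), ‖u i ω‖
        ≤ (l + 1 : ℕ) * (22 * (σ * √m) * (2 * T)) := by
          gcongr
          exact h2'.trans (by gcongr)
      _ = _ := by ring
  have hkr : (1 : ℝ) ≤ (l + 1 : ℕ) := by exact_mod_cast Nat.succ_pos l
  have hτT : τ ≤ T := by
    rw [hτdef, div_le_iff₀ (by linarith)]
    have h1 : μ ^ 2 ≤ 1 := pow_le_one₀ hμ0.le hμ1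
    have hT0 : (0 : ℝ) ≤ T := Nat.cast_nonneg T
    nlinarith
  have hPE : P (⋃ z ∈ V, E z) ≤ ENNReal.ofReal (Real.exp (-(τ / 288))) := by
    refine (measure_biUnion_finset_le V E).trans ?_
    calc ∑ z ∈ V, P (E z) ≤ ∑ _z ∈ V, ENNReal.ofReal (Real.exp (-(τ / 144))) := by
          refine Finset.sum_le_sum fun z _ => ?_
          refine (measure_signedSum_lt_le hξ hσ hu hind hμ hμ0.le hμ1 hT (intVec z)).trans
            (le_of_eq ?_)
          congr 3
          rw [hτdef]
          field_simp
      _ = ENNReal.ofReal (V.card * Real.exp (-(τ / 144))) := by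
          rw [Finset.sum_const, nsmul_eq_mul, ENNReal.ofReal_mul (Nat.cast_nonneg _),
            ENNReal.ofReal_natCast]
      _ ≤ _ := by
          refine ENNReal.ofReal_le_ofReal ?_
          calc V.card * Real.exp (-(τ / 144)) ≤ Real.exp (τ / 288) * Real.exp (-(τ / 144)) := by
                gcongr
            _ = _ := by rw [← Real.exp_add]; congr 1; ring
  have hPu : P Eu ≤ ENNReal.ofReal (Real.exp (-(10 * τ))) := by
    refine (measure_sum_norm_input_ge_le hm hσ hu).trans
      (ENNReal.ofReal_le_ofReal (Real.exp_le_exp.2 ?_))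
    push_cast
    have : (0 : ℝ) ≤ l := Nat.cast_nonneg l
    linarith
  have hPw : P Ew ≤ ENNReal.ofReal (Real.exp (-(10 * τ))) := by
    refine (measure_sum_norm_attack_ge_le hx₀ hw hη T).trans
      (ENNReal.ofReal_le_ofReal (Real.exp_le_exp.2 ?_))
    push_cast
    linarith
  have hδ' : Real.exp (-(τ / 576)) ≤ δ := by
    rw [one_div, Real.log_inv] at hδτ
    rw [← Real.le_log_iff_exp_le hδ]
    linarith
  calc P _ ≤ P (((⋃ z ∈ V, E z) ∪ Eu) ∪ Ew) := measure_mono hsub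
    _ ≤ P (⋃ z ∈ V, E z) + P Eu + P Ew :=
        (measure_union_le _ _).trans (add_le_add_left (measure_union_le _ _) _)
    _ ≤ ENNReal.ofReal (Real.exp (-(τ / 288))) + ENNReal.ofReal (Real.exp (-(10 * τ))) +
        ENNReal.ofReal (Real.exp (-(10 * τ))) := add_le_add (add_le_add hPE hPu) hPw
    _ = ENNReal.ofReal (Real.exp (-(τ / 288)) + 2 * Real.exp (-(10 * τ))) := by
        rw [← ENNReal.ofReal_add (by positivity) (by positivity),
          ← ENNReal.ofReal_add (by positivity) (by positivity)]
        congr 1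
        ring
    _ ≤ _ := ENNReal.ofReal_le_ofReal ((exp_add_two_mul_exp_le hτ).trans hδ')

end

/-- The box used as a net: its side is polynomial in `d / μ`, so that the logarithm of its
cardinality is of order `d log (d / μ)`. -/
lemma card_intBox_le_exp {κ : Type*} [Fintype κ] [DecidableEq κ] {d μ : ℝ}
    (hd : d = Fintype.card κ) (hd2 : 2 ≤ d) (hμ0 : 0 < μ) (hμ1 : μ ≤ 1) :
    ((intBox κ ⌈2114 * d ^ 2 / μ⌉₊).card : ℝ) ≤ Real.exp (15 * (d * Real.log (d / μ))) := by
  have ha2 : 2 ≤ d / μ := by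
    rw [le_div_iff₀ hμ0]; nlinarith
  have ha0 : 0 < d / μ := by linarith
  have hM : (⌈2114 * d ^ 2 / μ⌉₊ : ℝ) ≤ 2114 * d ^ 2 / μ + 1 :=
    (Nat.ceil_lt_add_one (by positivity)).le
  have h1 : 2114 * d ^ 2 / μ ≤ 2114 * (d / μ) ^ 2 := by
    rw [div_pow, mul_div_assoc]
    have : μ ^ 2 ≤ μ := by nlinarith
    gcongr
  have h2 : 2 * (⌈2114 * d ^ 2 / μ⌉₊ : ℝ) + 1 ≤ (d / μ) ^ 15 := by
    have h3 : (2 : ℝ) ^ 13 ≤ (d / μ) ^ 13 := by gcongr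
    have h4 : (d / μ) ^ 15 = (d / μ) ^ 13 * (d / μ) ^ 2 := by ring
    have h5 : (4 : ℝ) ≤ (d / μ) ^ 2 := by nlinarith
    rw [h4]
    nlinarith
  rw [card_intBox]
  push_cast
  calc (2 * (⌈2114 * d ^ 2 / μ⌉₊ : ℝ) + 1) ^ Fintype.card κ
      ≤ ((d / μ) ^ 15) ^ Fintype.card κ := by gcongr
    _ = Real.exp (15 * (d * Real.log (d / μ))) := by
      rw [← pow_mul]
      nth_rewrite 1 [← Real.exp_log ha0]
      rw [← Real.exp_nat_mul, hd]
      congr 1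
      push_cast
      ring

/-- The side `M` of the box is large enough for `signedSum_ge_of_intBox`. -/
lemma two_mul_sqrt_mul_le_of_le {d k μ T σ s : ℝ} {M : ℕ} (hd1 : 1 ≤ d) (hμ0 : 0 < μ) (hμ1 : μ ≤ 1)
    (hT : 0 ≤ T) (hσ : 0 < σ) (hks : k * s ≤ d) (hM : 2114 * d ^ 2 / μ ≤ M) :
    2 * √d * (μ * T * σ / 24 + 44 * k * (σ * s) * T) ≤ μ * T * σ / 24 * M := by
  have h1 : √d ≤ d := by
    rw [Real.sqrt_le_left (by linarith)]
    nlinarith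
  have hTσ : 0 ≤ T * σ := by positivity
  have h2 : μ * T * σ / 24 + 44 * k * (σ * s) * T ≤ T * σ * (d * (2114 / 48)) := by
    have h3 : 44 * k * (σ * s) * T = T * σ * (44 * (k * s)) := by ring
    have h4 : μ * T * σ / 24 = T * σ * (μ / 24) := by ring
    rw [h3, h4, ← mul_add]
    refine mul_le_mul_of_nonneg_left ?_ hTσ
    linarith
  have h5 : 2114 * d ^ 2 ≤ M * μ := (div_le_iff₀ hμ0).1 hM
  have h6 : 0 ≤ T * σ * (d * (2114 / 48)) := by positivity
  calc 2 * √d * (μ * T * σ / 24 + 44 * k * (σ * s) * T)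
      ≤ 2 * √d * (T * σ * (d * (2114 / 48))) := by gcongr
    _ ≤ 2 * d * (T * σ * (d * (2114 / 48))) := by gcongr
    _ = T * σ / 24 * (2114 * d ^ 2) := by ring
    _ ≤ T * σ / 24 * (M * μ) := by gcongr
    _ = _ := by ring

end SysId

end

/-! ### The estimation error bound -/

theorem theorem1 :
    -- `c₁` is universal; `c₂` depends only on the stability constant `ψ`
    ∃ c₁ : ℝ, 0 < c₁ ∧ ∀ ψ : ℝ, 0 < ψ → ∃ c₂ : ℝ, 0 < c₂ ∧
    ∀ (n m r k T : ℕ) (ρ η σ δ q ν : ℝ) (p : unitInterval)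
      (A : Matrix (Fin n) (Fin n) ℝ) (B : Matrix (Fin n) (Fin m) ℝ)
      (C : Matrix (Fin r) (Fin n) ℝ) (D : Matrix (Fin r) (Fin m) ℝ)
      (Ω : Type*) [MeasurableSpace Ω] (P : Measure Ω) [IsProbabilityMeasure P]
      (x₀ : Ω → EuclideanSpace ℝ (Fin n)) (w : ℕ → Ω → EuclideanSpace ℝ (Fin n))
      (u : ℕ → Ω → EuclideanSpace ℝ (Fin m)) (ξ : ℕ → Ω → ℝ),
      1 ≤ k →
      Measurable x₀ → (∀ t, Measurable (w t)) →
      SysId.IsStable A ψ ρ →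
      SysId.IsSubGaussianAttack P x₀ w η →
      SysId.IsProbabilisticAttack P x₀ w ξ p →
      -- `p < 1 / (2 (k - 1))`, which is no restriction for `k = 1`
      2 * ((k : ℝ) - 1) * (p : ℝ) < 1 →
      0 < σ →
      SysId.IsGaussianInput P u σ (T + k - 1) →
      -- the attack times are independent of the inputs
      IndepFun (fun ω (t : ℕ) => ξ t ω) (fun ω (t : Fin (T + k - 1)) => u t ω) P →
      0 < δ → δ ≤ 1 →
      q = 1 - (1 - (p : ℝ)) ^ (k - 1) →
      ν = SysId.specNorm C / (1 - 2 * q) * (η / σ + Real.sqrt m * SysId.specNorm B) →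
      c₁ * ((k : ℝ) / (1 - 2 * q) ^ 2 *
        ((m : ℝ) * k * Real.log ((m : ℝ) * k / (1 - 2 * q)) + Real.log (1 / δ))) ≤ (T : ℝ) →
      P {ω | ¬ ∀ G : Matrix (Fin r) (Fin k × Fin m) ℝ,
          SysId.IsL2Estimate k T (fun t => u t ω)
            (SysId.observation A B C D (x₀ ω) (fun t => u t ω) (fun t => w t ω)) G →
          SysId.frobNorm (SysId.markovMatrix A B C D k - G) ≤ c₂ * (ρ ^ (k - 1) * ν / (1 - ρ))}
        ≤ ENNReal.ofReal δ := by
  -- `4320 = 15 * 288`: the net has `exp (15 d log (d / μ))` points, and half of the exponent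
  -- `τ / 144` of the tail bound, where `τ = μ² T / k`, is spent on the union over them
  refine ⟨4320, by norm_num, fun ψ hψ => ⟨4224 * ψ, by positivity, ?_⟩⟩
  intro n m r k T ρ η σ δ q ν p A B C D Ω _ P _ x₀ w u ξ hk hx₀ hw hA hη hξ hp hσ hu hind hδ hδ1
    hq hν hT
  obtain ⟨l, rfl⟩ : ∃ l, k = l + 1 := ⟨k - 1, by omega⟩
  have hp0 : 0 ≤ (p : ℝ) := p.2.1
  have hp1 : 0 ≤ 1 - (p : ℝ) := sub_nonneg.2 p.2.2
  rw [Nat.add_sub_cancel] at hq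
  obtain ⟨μ, hμq⟩ : ∃ μ, μ = 1 - 2 * q := ⟨_, rfl⟩
  rw [← hμq] at hν hT
  have hμ : μ = 2 * (1 - (p : ℝ)) ^ l - 1 := by rw [hμq, hq]; ring
  have hμ1 : μ ≤ 1 := by
    have := pow_le_one₀ hp1 (by linarith : 1 - (p : ℝ) ≤ 1) (n := l)
    linarith
  -- Bernoulli's inequality turns `2 (k - 1) p < 1` into `q < 1 / 2`
  have hμ0 : 0 < μ := by
    have h1 := one_add_mul_le_pow (a := -(p : ℝ)) (by linarith) l
    push_cast at hp
    rw [hμ, sub_eq_add_neg 1 (p : ℝ)]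
    linarith
  subst hν
  have hρ1 : 0 < 1 - ρ := sub_pos.2 hA.rho_lt_one
  rcases Nat.eq_zero_or_pos m with rfl | hm
  · -- there are no columns
    have h0 : ∀ G : Matrix (Fin r) (Fin (l + 1) × Fin 0) ℝ,
        SysId.frobNorm (SysId.markovMatrix A B C D (l + 1) - G) = 0 := by
      intro G
      simp [SysId.frobNorm]
    have hrhs : 0 ≤ 4224 * ψ * (ρ ^ (l + 1 - 1) * (SysId.specNorm C / μ *
        (η / σ + √((0 : ℕ) : ℝ) * SysId.specNorm B)) / (1 - ρ)) := by
      have := SysId.specNorm_nonneg B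
      have := SysId.specNorm_nonneg C
      have := hA.rho_nonneg
      have := hη.eta_pos
      positivity
    refine le_of_eq_of_le (b := 0) ?_ (by positivity)
    convert measure_empty (μ := P)
    rw [Set.eq_empty_iff_forall_notMem]
    intro ω hω
    exact hω fun G _ => (h0 G).trans_le hrhs
  have hkr : (1 : ℝ) ≤ (l + 1 : ℕ) := by exact_mod_cast Nat.succ_pos l
  have hmr : (1 : ℝ) ≤ m := by exact_mod_cast hm
  obtain ⟨d, hd⟩ : ∃ d : ℝ, d = m * (l + 1 : ℕ) := ⟨_, rfl⟩
  have hd1 : 1 ≤ d := by rw [hd]; nlinarith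
  have hcard : d = Fintype.card (Fin (l + 1) × Fin m) := by
    rw [hd, Fintype.card_prod, Fintype.card_fin, Fintype.card_fin]
    push_cast
    ring
  rw [← hd] at hT
  have hlog0 : 0 ≤ Real.log (1 / δ) := Real.log_nonneg ((one_le_div hδ).2 hδ1)
  have hlogd : 0 ≤ d * Real.log (d / μ) :=
    mul_nonneg (by linarith) (Real.log_nonneg ((one_le_div hμ0).2 (hμ1.trans hd1)))
  set τ := μ ^ 2 * T / (l + 1 : ℕ) with hτ
  have hτle : 4320 * (d * Real.log (d / μ) + Real.log (1 / δ)) ≤ τ := by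
    rw [hτ, le_div_iff₀ (by linarith)]
    have h1 := mul_le_mul_of_nonneg_left hT (by positivity : 0 ≤ μ ^ 2)
    refine le_trans (le_of_eq ?_) h1
    field_simp
  rcases Nat.eq_zero_or_pos T with rfl | hT0
  · -- an empty sample is allowed only for `δ = 1`
    have hτ0 : τ = 0 := by rw [hτ]; simp
    have h1 : Real.log (1 / δ) ≤ 0 := by linarith
    rw [one_div, Real.log_inv] at h1
    have h2 : 1 ≤ δ := by
      by_contra h
      have := Real.log_neg hδ (not_le.1 h)
      linarith
    exact prob_le_one.trans (by simpa using ENNReal.ofReal_le_ofReal h2)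
  have hT0r : (1 : ℝ) ≤ T := by exact_mod_cast hT0
  have hfinal := fun (hlT : l + 1 ≤ T) (hτ1 : 1 ≤ τ) => SysId.measure_frobNorm_gt_le (r := r) (δ := δ)
    hA B C D hx₀ hw hη hξ hσ hu hind hμ hμ0 hμ1 hm hlT hδ hτ1 (by linarith)
  by_cases hd2 : 2 ≤ d
  · have hlog2 : 0.69 ≤ Real.log (d / μ) := by
      have h1 : 2 ≤ d / μ := by
        rw [le_div_iff₀ hμ0]; nlinarith
      have h2 := Real.log_le_log (by norm_num) h1
      linarith [Real.log_two_gt_d9]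
    have hτ1 : 1 ≤ τ := by nlinarith
    have hlT : l + 1 ≤ T := by
      rw [hτ, le_div_iff₀ (by linarith), one_mul] at hτ1
      have h1 : μ ^ 2 ≤ 1 := pow_le_one₀ hμ0.le hμ1
      have h2 : ((l + 1 : ℕ) : ℝ) ≤ T := by nlinarith
      exact_mod_cast h2
    refine hfinal hlT hτ1 (SysId.intBox _ ⌈2114 * d ^ 2 / μ⌉₊) ?_ ?_
    · refine (SysId.card_intBox_le_exp hcard hd2 hμ0 hμ1).trans (Real.exp_le_exp.2 ?_)
      linarith
    · intro e U he hU hz v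
      have hks : ((l + 1 : ℕ) : ℝ) * √m ≤ d := by
        have h1 : √(m : ℝ) ≤ m := by
          rw [Real.sqrt_le_left (by linarith)]
          nlinarith
        rw [hd, mul_comm]
        gcongr
      have h := SysId.signedSum_ge_of_intBox he (by positivity) hU
        (Nat.ceil_pos.2 (by positivity)) (by
          rw [← hcard]
          exact SysId.two_mul_sqrt_mul_le_of_le hd1 hμ0 hμ1 (by linarith) hσ hks (Nat.le_ceil _))
        hz v
      refine le_trans (le_of_eq ?_) h
      ring
  · -- for `m = k = 1` the logarithm in the sample size vanishes, and so must the net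
    have hd1' : m * (l + 1) = 1 := by
      have h1 : m * (l + 1) < 2 := by
        have : ((m * (l + 1) : ℕ) : ℝ) < 2 := by
          rw [hd] at hd2
          push_cast at hd2 ⊢
          linarith
        exact_mod_cast this
      have h2 : 0 < m * (l + 1) := by positivity
      omega
    have hl : l = 0 := by
      have := Nat.eq_one_of_mul_eq_one_left hd1'
      omega
    have hτT : τ = T := by
      rw [hτ, hμ, hl]; norm_num
    refine hfinal (by omega) (by rw [hτT]; exact hT0r) {fun _ => 1} ?_ ?_
    · rw [Finset.card_singleton, Nat.cast_one]
      exact Real.one_le_exp (by positivity)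
    · intro e U _ _ hz v
      refine le_trans ?_ (SysId.signedSum_ge_of_card_eq_one (K := μ * T * σ / 24) ?_
        (hz _ (Finset.mem_singleton_self _)) v)
      · have : 0 ≤ μ * T * σ * ‖v‖ := by positivity
        linarith
      · rw [Fintype.card_prod, Fintype.card_fin, Fintype.card_fin, mul_comm, hd1']
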